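/- Setting. An inductive definition system $(\Sigma,\Phi)$ is a first-order signature $\Sigma$ with equality, finitely many of whose predicate symbols are declared inductive, $P_1,\dots,P_n$, the others being ordinary, with a finite set $\Phi$ of productions, i.e. rules with a conclusion $P_i(\vec t)$ and a finite list of premises that are atoms $Q(\vec u)$ ($Q$ ordinary) or $P_j(\vec t')$. Sequents $\Gamma\vdash\Delta$ consist of finite sets of formulas. $\mathrm{LKID}(\Sigma,\Phi)$ is Martin-Löf-style classical sequent calculus with inductive definitions, as presented by Brotherston and Simpson: axiom, weakening, cut, substitution, the usual left and right rules for $\neg,\vee,\wedge,\to,\exists,\forall$, the equality rules ($\Gamma\vdash t=t,\Delta$; and from $\Gamma[u/x,t/y]\vdash\Delta[u/x,t/y]$ infer $\Gamma[t/x,u/y],t=u\vdash\Delta[t/x,u/y]$), for every production the corresponding right-introduction rule, and for every inductive predicate $P_j$ its induction rule with arbitrary formulas as induction hypotheses for the predicates mutually dependent with $P_j$. A proof is a finite derivation tree. $\mathrm{LKID}^\omega(\Sigma,\Phi)$ has the same rules, except that the induction rules are replaced by the case-split rules: infer $\Gamma,P_i\vec u\vdash\Delta$ from the premises $$\Gamma,\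 \vec u=\vec t[\vec y],\ Q_1\vec u_1[\vec y],\dots,Q_h\vec u_h[\vec y],\ P_{j_1}\vec t_1[\vec y],\dots,P_{j_m}\vec t_m[\vec y]\vdash\Delta,$$ one for each production with conclusion $P_i\vec t$, with distinct fresh variables $\vec y$; the formulas $P_{j_k}\vec t_k[\vec y]$ are the case-descendants of the principal formula $P_i\vec u$. Pre-proofs are possibly infinite derivation trees without open leaves. A trace along an infinite path $(\Gamma_k\vdash\Delta_k)_k$ is a sequence of inductive atoms $\tau_k\in\Gamma_k$ such that: at a substitution rule with substitution $\theta$, $\tau_k=\tau_{k+1}[\theta]$; at a left equality rule with principal formula $t=u$, $\tau_k=F[t/x,u/y]$ and $\tau_{k+1}=F[u/x,t/y]$ for some $F,x,y$; at a case split, $\tau_{k+1}=\tau_k$, or $\tau_k$ is the principal formula and $\tau_{k+1}$ is a case-descendant of it (then $k$ is a progress point); at any other rule, $\tau_{k+1}=\tau_k$. The global trace condition says that every infinite path has a tail followed by a trace with infinitely many progress points. A proof in $\mathrm{CLKID}^\omega(\Sigma,\Phi)$ is a finite derivation tree in the rules of $\mathrm{LKID}^\omega$, together with a function assigning to every bud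 (open leaf) a companion (a node that is the conclusion of a rule and carries the same sequent), whose unfolding to a possibly infinite tree satisfies the global trace condition. A Henkin class for a structure $M$ is a family $\mathcal H_k\subseteq\mathcal P(M^k)$, $k\in\mathbb N$, that contains the diagonal of $M^2$ and the interpretations of all predicate symbols and is closed under fixing the last argument to an element of $M$, substitution of terms, complement, binary intersection and projection along the last coordinate. $(M,\mathcal H)$ is a Henkin model of $(\Sigma,\Phi)$ if $\mathcal H$ is a Henkin class for $M$ and $(P_1^M,\dots,P_n^M)$ is the least tuple $\vec X$ of members of $\mathcal H$ (of the appropriate arities) that is closed under the productions, i.e. $\varphi_\Phi(\vec X)\subseteq\vec X$ for the monotone operator $\varphi_\Phi$ of $\Phi$. Let $\Sigma_N=\{0,s,N,p\}$, where $0$ is a constant, $s$ a unary function symbol, $p$ an ordinary binary predicate symbol, and $N$ the only inductive predicate symbol (unary), with the productions $\Phi_N$: $N(0)$, and from $N(x)$ infer $N(s\,x)$. Write $1$ for $s\,0$, and $\forall x_1,\dots,x_k\in N.\,A$ for $\forall x_1\dots\forall x_k\,(N(x_1)\wedge\dots\wedge N(x_k)\to A)$. The 2-Hydra statement is $H=(H_a\wedge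 H_b\wedge H_c\wedge H_d\to\forall x,y\in N.\ p(x,y))$, where - $H_a=\forall x\in N.\ p(0,0)\wedge p(1,0)\wedge p(x,1)$, - $H_b=\forall x,y\in N.\ p(x,y)\to p(s\,x,s\,s\,y)$, - $H_c=\forall y\in N.\ p(s\,y,y)\to p(0,s\,s\,y)$, - $H_d=\forall x\in N.\ p(s\,x,x)\to p(s\,s\,x,0)$. The $(0,s)$-axioms are $\forall x\in N.\ s\,x\ne 0$ and $\forall x,y\in N.\ s\,x=s\,y\to x=y$. Let $\mathcal M$ be the $\Sigma_N$-structure with universe the disjoint union $\mathbb N+\mathbb Z$, $0_{\mathcal M}=0\in\mathbb N$, $s_{\mathcal M}$ the successor on each summand, $N_{\mathcal M}=\mathbb N+\mathbb Z$, and $p_{\mathcal M}$ the complement of $\pi_1\cup\pi_2\cup\pi_3$, where, writing $n_{\mathbb N}$ and $z_{\mathbb Z}$ for the elements of the two summands, $$\pi_1=\{(n_{\mathbb N},(2n)_{\mathbb Z})\mid n\in\mathbb N\},\quad \pi_2=\{(n_{\mathbb Z},(2n)_{\mathbb N})\mid n\in\mathbb N\},\quad \pi_3=\{((-1-n)_{\mathbb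 Z},(-2-2n)_{\mathbb Z})\mid n\in\mathbb N\}.$$ Let $\mathcal H_{\mathcal M}$ be the family of all subsets of $\mathcal M^k$, $k\in\mathbb N$, that are first-order definable in $\mathcal M$ with parameters. Theorem. 1. The sequent $\vdash H$ has a proof in $\mathrm{CLKID}^\omega(\Sigma_N,\Phi_N)$. 2. The sequent $\vdash H$ has no proof in $\mathrm{LKID}(\Sigma_N,\Phi_N)$, even when the $(0,s)$-axioms are added as axioms. 3. $(\mathcal M,\mathcal H_{\mathcal M})$ is a Henkin model of $(\Sigma_N,\Phi_N)$; the $(0,s)$-axioms are true in $\mathcal M$, and $H$ is false in $\mathcal M$. -/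

import Mathlib

namespace HydraID

open FirstOrder FirstOrder.Language

/-! ## First-order syntax

Formulas are Mathlib's first-order formulas (with equality) whose free variables are named by
natural numbers. As usual in classical logic, Mathlib codes negation, disjunction, conjunction and
`∃` by implication, falsity and `∀`; every logical rule of the calculus is nevertheless included
below for every connective. -/

section Formulas

variable {L : FirstOrder.Language.{0, 0}}

/-- Replace the free variable `x` by a bound variable. -/
def bind (x : ℕ) (F : L.Formula ℕ) : L.BoundedFormula ℕ 1 :=
  BoundedFormula.relabel (n := 1) (k := 0)
    (fun v => if v = x then Sum.inr 0 else Sum.inl v) F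

/-- The formula `∀ x. F`. -/
def allF (x : ℕ) (F : L.Formula ℕ) : L.Formula ℕ := (bind x F).all

/-- The formula `∃ x. F`. -/
def exF (x : ℕ) (F : L.Formula ℕ) : L.Formula ℕ := (bind x F).ex

/-- The substitution `[t/x]`. -/
def subst1 (x : ℕ) (t : L.Term ℕ) : ℕ → L.Term ℕ :=
  fun v => if v = x then t else Term.var v

/-- The simultaneous substitution `[t/x, u/y]` (used with `x ≠ y`). -/
def subst2 (x : ℕ) (t : L.Term ℕ) (y : ℕ) (u : L.Term ℕ) : ℕ → L.Term ℕ :=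
  fun v => if v = x then t else if v = y then u else Term.var v

noncomputable instance formulaDecEq : DecidableEq (L.BoundedFormula ℕ 0) := Classical.decEq _

variable (L) in
/-- A sequent `Γ ⊢ Δ` of finite sets of formulas. -/
structure Sequent where
  left : Finset (L.Formula ℕ)
  right : Finset (L.Formula ℕ)

/-- The free variables of a finite set of formulas. -/
def fvSet (Γ : Finset (L.Formula ℕ)) : Set ℕ :=
  {v | ∃ F ∈ Γ, v ∈ BoundedFormula.freeVarFinset F}

/-- `Γ[θ]`: a substitution applied to all formulas of a finite set. -/
noncomputable def substSet (θ : ℕ → L.Term ℕ) (Γ : Finset (L.Formula ℕ)) :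
    Finset (L.Formula ℕ) :=
  Γ.image fun F => BoundedFormula.subst F θ

/-- `M ⊨ F`: the formula is true under every valuation. -/
def Models (M : Type) [L.Structure M] (F : L.Formula ℕ) : Prop :=
  ∀ ρ : ℕ → M, F.Realize ρ

end Formulas

/-! ## Inductive definition systems -/

/-- Finitely many distinct predicate symbols `P_0, …, P_{n-1}` of `L`, declared to be inductive. All
other predicate symbols of `L` are ordinary. -/
structure IndSig (L : FirstOrder.Language.{0, 0}) where
  n : ℕ
  arity : Fin n → ℕ
  sym : (i : Fin n) → L.Relations (arity i)
  sym_inj : ∀ i j, (⟨arity i, sym i⟩ : Σ k, L.Relations k) = ⟨arity j, sym j⟩ → i = j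

/-- A production with conclusion `P_i (head)` and premises `Q (u)` for `⟨_, Q, u⟩` in `ord`
(`Q` an ordinary predicate symbol) and `P_j (t)` for `⟨j, t⟩` in `ind`. Its variables `x⃗` are
indexed by `Fin nvars`. -/
structure Production {L : FirstOrder.Language.{0, 0}} (S : IndSig L) (i : Fin S.n) where
  nvars : ℕ
  ord : List (Σ k, L.Relations k × (Fin k → L.Term (Fin nvars)))
  ord_ordinary : ∀ q ∈ ord, ∀ j, (⟨q.1, q.2.1⟩ : Σ k, L.Relations k) ≠ ⟨S.arity j, S.sym j⟩
  ind : List (Σ j : Fin S.n, Fin (S.arity j) → L.Term (Fin nvars))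
  head : Fin (S.arity i) → L.Term (Fin nvars)

/-- An inductive definition system `(Σ, Φ)`; `prods i` lists the productions with conclusion
`P_i`. -/
structure IndSystem (L : FirstOrder.Language.{0, 0}) extends IndSig L where
  prods : (i : Fin n) → List (Production toIndSig i)

section Semantics

variable {L : FirstOrder.Language.{0, 0}} (S : IndSystem L) (M : Type) [L.Structure M]

/-- The monotone operator `φ_Φ` on tuples of relations. -/
def IndSystem.op (X : (i : Fin S.n) → Set (Fin (S.arity i) → M)) :
    (i : Fin S.n) → Set (Fin (S.arity i) → M) :=
  fun i => {a | ∃ pr ∈ S.prods i, ∃ ρ : Fin pr.nvars → M,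
    (∀ q ∈ pr.ord, Structure.RelMap q.2.1 (fun l => (q.2.2 l).realize ρ)) ∧
    (∀ b ∈ pr.ind, (fun l => (b.2 l).realize ρ) ∈ X b.1) ∧
    a = fun l => (pr.head l).realize ρ}

variable (L) in
/-- A Henkin class for the structure `M`: a family `ℋ_k ⊆ 𝒫(M^k)` with the usual closure
conditions. -/
structure IsHenkinClass (ℋ : (k : ℕ) → Set (Set (Fin k → M))) : Prop where
  diag : {v : Fin 2 → M | v 0 = v 1} ∈ ℋ 2
  rel : ∀ (k : ℕ) (Q : L.Relations k), {v : Fin k → M | Structure.RelMap Q v} ∈ ℋ k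
  section_mem : ∀ (k : ℕ), ∀ R ∈ ℋ (k + 1), ∀ d : M,
    {v : Fin k → M | (Fin.snoc v d : Fin (k + 1) → M) ∈ R} ∈ ℋ k
  term : ∀ (k h : ℕ), ∀ R ∈ ℋ h, ∀ t : Fin h → L.Term (Fin k),
    {v : Fin k → M | (fun l => (t l).realize v) ∈ R} ∈ ℋ k
  compl : ∀ (k : ℕ), ∀ R ∈ ℋ k, Rᶜ ∈ ℋ k
  inter : ∀ (k : ℕ), ∀ R₁ ∈ ℋ k, ∀ R₂ ∈ ℋ k, R₁ ∩ R₂ ∈ ℋ k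
  proj : ∀ (k : ℕ), ∀ R ∈ ℋ (k + 1),
    {v : Fin k → M | ∃ d : M, (Fin.snoc v d : Fin (k + 1) → M) ∈ R} ∈ ℋ k

variable (L) in
/-- The family `ℋ_M` of the sets that are first-order definable in `M` with parameters. -/
def definableFamily : (k : ℕ) → Set (Set (Fin k → M)) :=
  fun _ => {R | (Set.univ : Set M).Definable L R}

/-- `(M, ℋ)` is a Henkin model: `ℋ` is a Henkin class for `M`, and the interpretations of the
inductive predicates form the least prefixed point (`φ_Φ(X) ⊆ X`) of `φ_Φ` restricted to `ℋ`. -/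
def IsHenkinModel (ℋ : (k : ℕ) → Set (Set (Fin k → M))) : Prop :=
  IsHenkinClass L M ℋ ∧
  IsLeast {X : (i : Fin S.n) → Set (Fin (S.arity i) → M) |
      (∀ i, X i ∈ ℋ (S.arity i)) ∧ ∀ i, S.op M X i ⊆ X i}
    (fun i => {v | Structure.RelMap (S.sym i) v})

end Semantics

/-! ## The rules common to both systems -/

section Rules

variable {L : FirstOrder.Language.{0, 0}} (S : IndSystem L)

/-- The inductive atom `P_i (t)`. -/
def IndSystem.atom (i : Fin S.n) (t : Fin (S.arity i) → L.Term ℕ) : L.Formula ℕ :=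
  (S.sym i).formula t

/-- The instances of the rules common to both systems (structural rules, logical rules, and the
right-introduction rules of the inductive predicates), with their data and side conditions. The
conclusion and the premises are given by `CommonRule.concl` and `CommonRule.prems`. -/
inductive CommonRule where
  | ax (Γ Δ : Finset (L.Formula ℕ)) (h : (Γ ∩ Δ).Nonempty)
  | wk (Γ Δ Γ' Δ' : Finset (L.Formula ℕ)) (hΓ : Γ ⊆ Γ') (hΔ : Δ ⊆ Δ')
  | cut (Γ Δ : Finset (L.Formula ℕ)) (F : L.Formula ℕ)
  | subst (Γ Δ : Finset (L.Formula ℕ)) (θ : ℕ → L.Term ℕ)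
  | negL (Γ Δ : Finset (L.Formula ℕ)) (F : L.Formula ℕ)
  | negR (Γ Δ : Finset (L.Formula ℕ)) (F : L.Formula ℕ)
  | orL (Γ Δ : Finset (L.Formula ℕ)) (F G : L.Formula ℕ)
  | orR (Γ Δ : Finset (L.Formula ℕ)) (F G : L.Formula ℕ)
  | andL (Γ Δ : Finset (L.Formula ℕ)) (F G : L.Formula ℕ)
  | andR (Γ Δ : Finset (L.Formula ℕ)) (F G : L.Formula ℕ)
  | impL (Γ Δ : Finset (L.Formula ℕ)) (F G : L.Formula ℕ)
  | impR (Γ Δ : Finset (L.Formula ℕ)) (F G : L.Formula ℕ)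
  | exL (Γ Δ : Finset (L.Formula ℕ)) (x : ℕ) (F : L.Formula ℕ) (hx : x ∉ fvSet Γ ∪ fvSet Δ)
  | exR (Γ Δ : Finset (L.Formula ℕ)) (x : ℕ) (F : L.Formula ℕ) (t : L.Term ℕ)
  | allL (Γ Δ : Finset (L.Formula ℕ)) (x : ℕ) (F : L.Formula ℕ) (t : L.Term ℕ)
  | allR (Γ Δ : Finset (L.Formula ℕ)) (x : ℕ) (F : L.Formula ℕ) (hx : x ∉ fvSet Γ ∪ fvSet Δ)
  | eqL (Γ Δ : Finset (L.Formula ℕ)) (x y : ℕ) (hxy : x ≠ y) (t u : L.Term ℕ)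
  | eqR (Γ Δ : Finset (L.Formula ℕ)) (t : L.Term ℕ)
  | intro (Γ Δ : Finset (L.Formula ℕ)) (i : Fin S.n) (pr : Production S.toIndSig i)
      (hpr : pr ∈ S.prods i) (u : Fin pr.nvars → L.Term ℕ)

variable {S}

/-- The conclusion of a rule instance. -/
noncomputable def CommonRule.concl : CommonRule S → Sequent L
  | ax Γ Δ _ => ⟨Γ, Δ⟩
  | wk _ _ Γ' Δ' _ _ => ⟨Γ', Δ'⟩
  | cut Γ Δ _ => ⟨Γ, Δ⟩
  | subst Γ Δ θ => ⟨substSet θ Γ, substSet θ Δ⟩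
  | negL Γ Δ F => ⟨insert F.not Γ, Δ⟩
  | negR Γ Δ F => ⟨Γ, insert F.not Δ⟩
  | orL Γ Δ F G => ⟨insert (F ⊔ G) Γ, Δ⟩
  | orR Γ Δ F G => ⟨Γ, insert (F ⊔ G) Δ⟩
  | andL Γ Δ F G => ⟨insert (F ⊓ G) Γ, Δ⟩
  | andR Γ Δ F G => ⟨Γ, insert (F ⊓ G) Δ⟩
  | impL Γ Δ F G => ⟨insert (F.imp G) Γ, Δ⟩
  | impR Γ Δ F G => ⟨Γ, insert (F.imp G) Δ⟩
  | exL Γ Δ x F _ => ⟨insert (exF x F) Γ, Δ⟩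
  | exR Γ Δ x F _ => ⟨Γ, insert (exF x F) Δ⟩
  | allL Γ Δ x F _ => ⟨insert (allF x F) Γ, Δ⟩
  | allR Γ Δ x F _ => ⟨Γ, insert (allF x F) Δ⟩
  | eqL Γ Δ x y _ t u =>
      ⟨insert (t.equal u) (substSet (subst2 x t y u) Γ), substSet (subst2 x t y u) Δ⟩
  | eqR Γ Δ t => ⟨Γ, insert (t.equal t) Δ⟩
  | intro Γ Δ i pr _ u => ⟨Γ, insert (S.atom i fun l => (pr.head l).subst u) Δ⟩

/-- The list of premises of a rule instance. -/
noncomputable def CommonRule.prems : CommonRule S → List (Sequent L)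
  | ax _ _ _ => []
  | wk Γ Δ _ _ _ _ => [⟨Γ, Δ⟩]
  | cut Γ Δ F => [⟨Γ, insert F Δ⟩, ⟨insert F Γ, Δ⟩]
  | subst Γ Δ _ => [⟨Γ, Δ⟩]
  | negL Γ Δ F => [⟨Γ, insert F Δ⟩]
  | negR Γ Δ F => [⟨insert F Γ, Δ⟩]
  | orL Γ Δ F G => [⟨insert F Γ, Δ⟩, ⟨insert G Γ, Δ⟩]
  | orR Γ Δ F G => [⟨Γ, insert F (insert G Δ)⟩]
  | andL Γ Δ F G => [⟨insert F (insert G Γ), Δ⟩]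
  | andR Γ Δ F G => [⟨Γ, insert F Δ⟩, ⟨Γ, insert G Δ⟩]
  | impL Γ Δ F G => [⟨Γ, insert F Δ⟩, ⟨insert G Γ, Δ⟩]
  | impR Γ Δ F G => [⟨insert F Γ, insert G Δ⟩]
  | exL Γ Δ _ F _ => [⟨insert F Γ, Δ⟩]
  | exR Γ Δ x F t => [⟨Γ, insert (BoundedFormula.subst F (subst1 x t)) Δ⟩]
  | allL Γ Δ x F t => [⟨insert (BoundedFormula.subst F (subst1 x t)) Γ, Δ⟩]
  | allR Γ Δ _ F _ => [⟨Γ, insert F Δ⟩]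
  | eqL Γ Δ x y _ t u => [⟨substSet (subst2 x u y t) Γ, substSet (subst2 x u y t) Δ⟩]
  | eqR _ _ _ => []
  | intro Γ Δ _ pr _ u =>
      (pr.ord.map fun q => ⟨Γ, insert (q.2.1.formula fun l => (q.2.2 l).subst u) Δ⟩) ++
      (pr.ind.map fun b => ⟨Γ, insert (S.atom b.1 fun l => (b.2 l).subst u) Δ⟩)

end Rules

/-! ## The system LKID -/

section LKID

variable {L : FirstOrder.Language.{0, 0}} (S : IndSystem L)

/-- `P_j` is a premise of `P_i`. -/
def IndSystem.IsPremiseOf (j i : Fin S.n) : Prop :=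
  ∃ pr ∈ S.prods i, ∃ b ∈ pr.ind, b.1 = j

/-- Mutual dependency: chains of the premise relation (possibly empty) in both directions. -/
def IndSystem.MutDep (i j : Fin S.n) : Prop :=
  Relation.ReflTransGen S.IsPremiseOf i j ∧ Relation.ReflTransGen S.IsPremiseOf j i

/-- Induction hypotheses: `F i` is the formula `F_i`, whose induction variables `z⃗_i` are
`Sum.inr 0, Sum.inr 1, …` and whose other free variables are `Sum.inl v`. -/
abbrev IndSystem.IndHyps : Type :=
  (i : Fin S.n) → L.Formula (ℕ ⊕ Fin (S.arity i))

variable {S}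

/-- `F_i t⃗`, i.e. `F_i[t⃗/z⃗_i]`. -/
def hypInst (F : S.IndHyps) (i : Fin S.n) (t : Fin (S.arity i) → L.Term ℕ) : L.Formula ℕ :=
  BoundedFormula.subst (F i) (Sum.elim Term.var t)

open Classical in
/-- `G_i t⃗` for the induction rule of `P_j`. -/
noncomputable def hypInstG (F : S.IndHyps) (j i : Fin S.n)
    (t : Fin (S.arity i) → L.Term ℕ) : L.Formula ℕ :=
  if S.MutDep i j then hypInst F i t else S.atom i t

/-- The minor premise for a production of `P_i` in the induction rule for `P_j`, with the variables
of the production named by `y`. -/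
noncomputable def minorPremise (Γ Δ : Finset (L.Formula ℕ)) (F : S.IndHyps) (j i : Fin S.n)
    (pr : Production S.toIndSig i) (y : Fin pr.nvars → ℕ) : Sequent L :=
  ⟨Γ ∪ (pr.ord.map fun q => q.2.1.formula fun l => (q.2.2 l).relabel y).toFinset
     ∪ (pr.ind.map fun b => hypInstG F j b.1 fun l => (b.2 l).relabel y).toFinset,
   insert (hypInst F i fun l => (pr.head l).relabel y) Δ⟩

variable (S) in
/-- Provability in `LKID(Σ, Φ)` extended by the formulas in `Ax` as additional axioms: existence of
a finite derivation tree. Plain `LKID(Σ, Φ)` is the case `Ax = ∅`. -/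
inductive LKIDProvable (Ax : Set (L.Formula ℕ)) : Sequent L → Prop
  | common (r : CommonRule S) (h : ∀ s ∈ r.prems, LKIDProvable Ax s) : LKIDProvable Ax r.concl
  | given (Γ Δ : Finset (L.Formula ℕ)) (A : L.Formula ℕ) (hA : A ∈ Ax) :
      LKIDProvable Ax ⟨Γ, insert A Δ⟩
  | ind (Γ Δ : Finset (L.Formula ℕ)) (j : Fin S.n) (u : Fin (S.arity j) → L.Term ℕ)
      (F : S.IndHyps) (y : (i : Fin S.n) → (pr : Production S.toIndSig i) → Fin pr.nvars → ℕ)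
      (y_inj : ∀ i, ∀ pr ∈ S.prods i, Function.Injective (y i pr))
      (y_fresh : ∀ i, ∀ pr ∈ S.prods i, ∀ l,
        y i pr l ∉ fvSet (insert (S.atom j u) Γ) ∪ fvSet Δ ∧
        ∀ i', Sum.inl (y i pr l) ∉ BoundedFormula.freeVarFinset (F i'))
      (minor : ∀ i, S.MutDep i j → ∀ pr ∈ S.prods i,
        LKIDProvable Ax (minorPremise Γ Δ F j i pr (y i pr)))
      (major : LKIDProvable Ax ⟨insert (hypInst F j u) Γ, Δ⟩) :
      LKIDProvable Ax ⟨insert (S.atom j u) Γ, Δ⟩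

end LKID

/-! ## The systems LKID^ω and CLKID^ω -/

section Cyclic

variable {L : FirstOrder.Language.{0, 0}} (S : IndSystem L)

/-- The rule instances of `LKID^ω`: the common rules, and the case-split rule for `P_j` with
principal formula `P_j (u)`, where `y pr` are the distinct fresh variables used in the case
distinction of the production `pr`. -/
inductive OmegaRule where
  | common (r : CommonRule S)
  | case (Γ Δ : Finset (L.Formula ℕ)) (j : Fin S.n) (u : Fin (S.arity j) → L.Term ℕ)
      (y : (pr : Production S.toIndSig j) → Fin pr.nvars → ℕ)
      (y_inj : ∀ pr ∈ S.prods j, Function.Injective (y pr))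
      (y_fresh : ∀ pr ∈ S.prods j, ∀ l, y pr l ∉ fvSet (insert (S.atom j u) Γ) ∪ fvSet Δ)

variable {S}

/-- The case distinction of a production. -/
noncomputable def caseDistinction (Γ Δ : Finset (L.Formula ℕ)) {j : Fin S.n}
    (u : Fin (S.arity j) → L.Term ℕ) (pr : Production S.toIndSig j) (y : Fin pr.nvars → ℕ) :
    Sequent L :=
  ⟨Γ ∪ (Finset.univ.image fun l => (u l).equal ((pr.head l).relabel y))
     ∪ (pr.ord.map fun q => q.2.1.formula fun l => (q.2.2 l).relabel y).toFinset
     ∪ (pr.ind.map fun b => S.atom b.1 fun l => (b.2 l).relabel y).toFinset, Δ⟩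

/-- The conclusion of a rule instance of `LKID^ω`. -/
noncomputable def OmegaRule.concl : OmegaRule S → Sequent L
  | common r => r.concl
  | case Γ Δ j u _ _ _ => ⟨insert (S.atom j u) Γ, Δ⟩

/-- The list of premises of a rule instance of `LKID^ω`. -/
noncomputable def OmegaRule.prems : OmegaRule S → List (Sequent L)
  | common r => r.prems
  | case Γ Δ j u y _ _ => (S.prods j).map fun pr => caseDistinction Γ Δ u pr (y pr)

/-- `r.Progress i τ τ'`: the rule `r` is a case split, `τ` is its principal formula, and `τ'` is a
case-descendant of `τ` in the premise number `i`. -/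
def OmegaRule.Progress (r : OmegaRule S) (i : ℕ) (τ τ' : L.Formula ℕ) : Prop :=
  match r with
  | common _ => False
  | case _ _ j u y _ _ => τ = S.atom j u ∧
      ∃ pr, (S.prods j)[i]? = some pr ∧
        ∃ b ∈ pr.ind, τ' = S.atom b.1 fun l => (b.2 l).relabel (y pr)

/-- `r.TraceStep i τ τ'`: a trace may go from `τ` in the conclusion of `r` to `τ'` in the premise
number `i`. -/
def OmegaRule.TraceStep (r : OmegaRule S) (i : ℕ) (τ τ' : L.Formula ℕ) : Prop :=
  match r with
  | common (.subst _ _ θ) => τ = BoundedFormula.subst τ' θ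
  | common (.eqL _ _ _ _ _ t u) => ∃ (F : L.Formula ℕ) (x y : ℕ), x ≠ y ∧
      τ = BoundedFormula.subst F (subst2 x t y u) ∧ τ' = BoundedFormula.subst F (subst2 x u y t)
  | common _ => τ' = τ
  | case Γ Δ j u y y_inj y_fresh =>
      τ' = τ ∨ (case Γ Δ j u y y_inj y_fresh : OmegaRule S).Progress i τ τ'

/-- A pre-proof of `LKID^ω` of the sequent `s`: a possibly infinite derivation tree without buds.
Nodes are addressed by the finite sequences of the child numbers that lead to them from the root;
`label p` is the rule instance at the node `p`, and `none` if there is no such node. -/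
structure PreProof (S : IndSystem L) (s : Sequent L) where
  label : List ℕ → Option (OmegaRule S)
  root : ∃ r, label [] = some r ∧ r.concl = s
  child : ∀ p r, label p = some r → ∀ i, ∀ h : i < r.prems.length,
    ∃ r', label (p ++ [i]) = some r' ∧ r'.concl = r.prems[i]
  no_child : ∀ p r, label p = some r → ∀ i, r.prems.length ≤ i → label (p ++ [i]) = none
  outside : ∀ p, label p = none → ∀ i, label (p ++ [i]) = none

/-- An infinite path in a pre-proof. -/
def PreProof.IsPath {s : Sequent L} (P : PreProof S s) (π : ℕ → List ℕ) : Prop :=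
  ∀ n, (P.label (π n)).isSome ∧ ∃ i, π (n + 1) = π n ++ [i]

/-- `n` is a progress point of `τ`. -/
def PreProof.IsProgressPoint {s : Sequent L} (P : PreProof S s) (π : ℕ → List ℕ)
    (τ : ℕ → L.Formula ℕ) (n : ℕ) : Prop :=
  ∃ r i, P.label (π n) = some r ∧ π (n + 1) = π n ++ [i] ∧ r.Progress i (τ n) (τ (n + 1))

/-- `τ` is a trace following the path `π`. -/
def PreProof.IsTrace {s : Sequent L} (P : PreProof S s) (π : ℕ → List ℕ)
    (τ : ℕ → L.Formula ℕ) : Prop :=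
  ∀ n, (∃ j t, τ n = S.atom j t) ∧
    ∃ r i, P.label (π n) = some r ∧ π (n + 1) = π n ++ [i] ∧
      τ n ∈ r.concl.left ∧ r.TraceStep i (τ n) (τ (n + 1))

/-- The global trace condition: some tail of every infinite path is followed by an infinitely
progressing trace. An `LKID^ω` proof is a pre-proof with this property. -/
def PreProof.GlobalTrace {s : Sequent L} (P : PreProof S s) : Prop :=
  ∀ π, P.IsPath π → ∃ (k : ℕ) (τ : ℕ → L.Formula ℕ),
    P.IsTrace (fun n => π (k + n)) τ ∧
    ∀ m, ∃ n ≥ m, P.IsProgressPoint (fun n => π (k + n)) τ n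

variable (S) in
/-- Finite trees of sequents whose inner nodes and leaves carry rule instances of `LKID^ω` (and
their conclusions), and whose buds carry sequents. -/
inductive DTree where
  | bud (s : Sequent L)
  | node (r : OmegaRule S) (ch : Fin r.prems.length → DTree)

/-- The sequent at the root. -/
noncomputable def DTree.concl : DTree S → Sequent L
  | bud s => s
  | node r _ => r.concl

/-- The tree is a derivation tree: the children of every node are its premises. -/
def DTree.IsDerivation : DTree S → Prop
  | bud _ => True
  | node r ch => ∀ i, (ch i).concl = r.prems.get i ∧ (ch i).IsDerivation

/-- The subtree at an address. -/
noncomputable def DTree.sub : DTree S → List ℕ → Option (DTree S)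
  | T, [] => some T
  | bud _, _ :: _ => none
  | node r ch, i :: p => if h : i < r.prems.length then (ch ⟨i, h⟩).sub p else none

/-- A cyclic pre-proof: a finite derivation tree with a function that assigns to (the address of)
every bud (the address of) a companion, i.e. a non-bud node with the same sequent. -/
structure CyclicPreProof (S : IndSystem L) (s : Sequent L) where
  tree : DTree S
  isDerivation : tree.IsDerivation
  root : tree.concl = s
  companion : List ℕ → List ℕ
  companion_spec : ∀ p b, tree.sub p = some (.bud b) →
    ∃ r ch, tree.sub (companion p) = some (.node r ch) ∧ r.concl = b

namespace CyclicPreProof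

variable {s : Sequent L} (C : CyclicPreProof S s)

/-- Jump from a bud to its companion; do nothing at other addresses. -/
noncomputable def resolve (p : List ℕ) : List ℕ :=
  match C.tree.sub p with
  | some (.bud _) => C.companion p
  | _ => p

/-- The node of the finite tree that is visited at an address of the unfolding. -/
noncomputable def position (p : List ℕ) : List ℕ :=
  p.foldl (fun q i => C.resolve (q ++ [i])) (C.resolve [])

/-- The rule instance at an address of the unfolding. -/
noncomputable def unfoldLabel (p : List ℕ) : Option (OmegaRule S) :=
  match C.tree.sub (C.position p) with
  | some (.node r _) => some r
  | _ => none

theorem position_append (p : List ℕ) (i : ℕ) :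
    C.position (p ++ [i]) = C.resolve (C.position p ++ [i]) := by
  simp [position, List.foldl_append]

theorem _root_.HydraID.DTree.sub_append (T : DTree S) (p q : List ℕ) :
    T.sub (p ++ q) = (T.sub p).bind fun T' => T'.sub q := by
  induction p generalizing T with
  | nil => simp [DTree.sub]
  | cons i p ih =>
    cases T with
    | bud b => simp [DTree.sub]
    | node r ch =>
      simp only [List.cons_append, DTree.sub]
      split_ifs with h
      · exact ih _
      · rfl

theorem _root_.HydraID.DTree.IsDerivation.sub {T T' : DTree S} {p : List ℕ}
    (hT : T.IsDerivation) (h : T.sub p = some T') : T'.IsDerivation := by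
  induction p generalizing T with
  | nil =>
    simp only [DTree.sub, Option.some.injEq] at h
    exact h ▸ hT
  | cons i p ih =>
    cases T with
    | bud b => simp [DTree.sub] at h
    | node r ch =>
      simp only [DTree.sub] at h
      split_ifs at h with hi
      exact ih (hT ⟨i, hi⟩).2 h

/-- At an address of a subtree `T`, resolving leads to a rule with the same conclusion. -/
theorem resolve_spec {p : List ℕ} {T : DTree S} (h : C.tree.sub p = some T) :
    ∃ r ch, C.tree.sub (C.resolve p) = some (.node r ch) ∧ r.concl = T.concl := by
  cases T with
  | bud b =>
    obtain ⟨r, ch, h1, h2⟩ := C.companion_spec p b h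
    exact ⟨r, ch, by simp [resolve, h, h1], h2⟩
  | node r ch => exact ⟨r, ch, by simp [resolve, h], rfl⟩

theorem unfoldLabel_eq_some {p : List ℕ} {r : OmegaRule S} :
    C.unfoldLabel p = some r ↔ ∃ ch, C.tree.sub (C.position p) = some (.node r ch) := by
  unfold unfoldLabel
  split
  · rename_i r' ch' h
    simp only [Option.some.injEq, h, DTree.node.injEq]
    constructor
    · rintro rfl
      exact ⟨ch', rfl, HEq.rfl⟩
    · rintro ⟨ch, h1, -⟩
      exact h1
  · rename_i h
    simp only [reduceCtorEq, false_iff, not_exists]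
    exact fun ch hch => h r ch hch

theorem position_eq (p : List ℕ) :
    ∃ q, C.position p = C.resolve q := by
  induction p using List.reverseRecOn with
  | nil => exact ⟨[], rfl⟩
  | append_singleton p i _ => exact ⟨_, C.position_append p i⟩

theorem unfoldLabel_eq_none {p : List ℕ} :
    C.unfoldLabel p = none ↔ C.tree.sub (C.position p) = none := by
  obtain ⟨q, hq⟩ := C.position_eq p
  rw [Option.eq_none_iff_forall_ne_some, Option.eq_none_iff_forall_ne_some]
  constructor
  · intro h T hT
    have hnode : ∃ r ch, C.tree.sub (C.position p) = some (.node r ch) := by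
      rw [hq]
      cases hs : C.tree.sub q with
      | some T' =>
        obtain ⟨r, ch, h1, -⟩ := C.resolve_spec hs
        exact ⟨r, ch, h1⟩
      | none =>
        rw [hq, show C.resolve q = q by simp [resolve, hs], hs] at hT
        cases hT
    obtain ⟨r, ch, h1⟩ := hnode
    exact h r (C.unfoldLabel_eq_some.2 ⟨ch, h1⟩)
  · intro h r hr
    obtain ⟨ch, h1⟩ := C.unfoldLabel_eq_some.1 hr
    exact h _ h1

/-- The unfolding of a cyclic pre-proof to a possibly infinite tree without buds. -/
noncomputable def unfold : PreProof S s where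
  label := C.unfoldLabel
  root := by
    obtain ⟨r, ch, h1, h2⟩ := C.resolve_spec (p := []) (T := C.tree) (by simp [DTree.sub])
    exact ⟨r, C.unfoldLabel_eq_some.2 ⟨ch, h1⟩, h2.trans C.root⟩
  child := by
    intro p r hr i hi
    obtain ⟨ch, hch⟩ := C.unfoldLabel_eq_some.1 hr
    have h1 : C.tree.sub (C.position p ++ [i]) = some (ch ⟨i, hi⟩) := by
      simp [DTree.sub_append, hch, DTree.sub, hi]
    obtain ⟨r', ch', h2, h3⟩ := C.resolve_spec h1
    refine ⟨r', C.unfoldLabel_eq_some.2 ⟨ch', by rw [position_append, h2]⟩, h3.trans ?_⟩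
    exact (C.isDerivation.sub hch ⟨i, hi⟩).1
  no_child := by
    intro p r hr i hi
    obtain ⟨ch, hch⟩ := C.unfoldLabel_eq_some.1 hr
    have h1 : C.tree.sub (C.position p ++ [i]) = none := by
      simp [DTree.sub_append, hch, DTree.sub, hi]
    rw [unfoldLabel_eq_none, position_append,
      show C.resolve (C.position p ++ [i]) = C.position p ++ [i] by simp [resolve, h1], h1]
  outside := by
    intro p hp i
    rw [unfoldLabel_eq_none] at hp
    have h1 : C.tree.sub (C.position p ++ [i]) = none := by
      simp [DTree.sub_append, hp]
    rw [unfoldLabel_eq_none, position_append,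
      show C.resolve (C.position p ++ [i]) = C.position p ++ [i] by simp [resolve, h1], h1]

end CyclicPreProof

variable (S) in
/-- Provability in `CLKID^ω(Σ, Φ)`: existence of a cyclic pre-proof whose unfolding satisfies the
global trace condition. -/
def CLKIDProvable (s : Sequent L) : Prop :=
  ∃ C : CyclicPreProof S s, C.unfold.GlobalTrace

end Cyclic

/-! ## The signature `{0, s, p, N}` and the 2-Hydra statement -/

/-- Function symbols. -/
inductive HydraFunc : ℕ → Type
  | zero : HydraFunc 0
  | succ : HydraFunc 1

/-- Predicate symbols. -/
inductive HydraRel : ℕ → Type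
  | N : HydraRel 1
  | p : HydraRel 2

/-- The signature `Σ_N`. -/
abbrev hydraLang : FirstOrder.Language.{0, 0} := ⟨HydraFunc, HydraRel⟩

/-- The term `0`. -/
def zeroT {V : Type} : hydraLang.Term V := Term.func (l := 0) HydraFunc.zero ![]

/-- The term `s t`. -/
def succT {V : Type} (t : hydraLang.Term V) : hydraLang.Term V :=
  Term.func (l := 1) HydraFunc.succ ![t]

/-- The formula `N t`. -/
def natF (t : hydraLang.Term ℕ) : hydraLang.Formula ℕ :=
  Relations.formula (L := hydraLang) (n := 1) HydraRel.N ![t]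

/-- The formula `p (t, u)`. -/
def pF (t u : hydraLang.Term ℕ) : hydraLang.Formula ℕ :=
  Relations.formula (L := hydraLang) (n := 2) HydraRel.p ![t, u]

/-- `N` is the only inductive predicate symbol. -/
abbrev hydraSig : IndSig hydraLang where
  n := 1
  arity := fun _ => 1
  sym := fun _ => HydraRel.N
  sym_inj := fun i j _ => Subsingleton.elim i j

/-- The production `N 0`. -/
def zeroProd (i : Fin hydraSig.n) : Production hydraSig i where
  nvars := 0
  ord := []
  ord_ordinary := by simp
  ind := []
  head := fun _ => zeroT

/-- The production with premise `N x` and conclusion `N (s x)`. -/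
def succProd (i : Fin hydraSig.n) : Production hydraSig i where
  nvars := 1
  ord := []
  ord_ordinary := by simp
  ind := [⟨i, fun _ => Term.var 0⟩]
  head := fun _ => succT (Term.var 0)

/-- The inductive definition system `(Σ_N, Φ_N)`. -/
abbrev hydraSystem : IndSystem hydraLang where
  toIndSig := hydraSig
  prods := fun i => [zeroProd i, succProd i]

/-- `∀ x ∈ N. F`. -/
def allN (x : ℕ) (F : hydraLang.Formula ℕ) : hydraLang.Formula ℕ :=
  allF x ((natF (Term.var x)).imp F)

/-- `∀ x, y ∈ N. F`. -/
def allN2 (x y : ℕ) (F : hydraLang.Formula ℕ) : hydraLang.Formula ℕ :=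
  allF x (allF y ((natF (Term.var x) ⊓ natF (Term.var y) : hydraLang.Formula ℕ).imp F))

/-- `∀ x ∈ N. p(0,0) ∧ p(1,0) ∧ p(x,1)`. -/
def Ha : hydraLang.Formula ℕ :=
  allN 0 (pF zeroT zeroT ⊓ (pF (succT zeroT) zeroT ⊓ pF (Term.var 0) (succT zeroT)))

/-- `∀ x, y ∈ N. p(x,y) → p(s x, s s y)`. -/
def Hb : hydraLang.Formula ℕ :=
  allN2 0 1 ((pF (Term.var 0) (Term.var 1)).imp
    (pF (succT (Term.var 0)) (succT (succT (Term.var 1)))))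

/-- `∀ y ∈ N. p(s y, y) → p(0, s s y)`. -/
def Hc : hydraLang.Formula ℕ :=
  allN 1 ((pF (succT (Term.var 1)) (Term.var 1)).imp
    (pF zeroT (succT (succT (Term.var 1)))))

/-- `∀ x ∈ N. p(s x, x) → p(s s x, 0)`. -/
def Hd : hydraLang.Formula ℕ :=
  allN 0 ((pF (succT (Term.var 0)) (Term.var 0)).imp
    (pF (succT (succT (Term.var 0))) zeroT))

/-- The 2-Hydra statement `H_a ∧ H_b ∧ H_c ∧ H_d → ∀ x, y ∈ N. p(x,y)`. -/
def hydraH : hydraLang.Formula ℕ :=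
  (Ha ⊓ (Hb ⊓ (Hc ⊓ Hd)) : hydraLang.Formula ℕ).imp (allN2 0 1 (pF (Term.var 0) (Term.var 1)))

/-- The `(0,s)`-axioms: `∀ x ∈ N. s x ≠ 0` and `∀ x, y ∈ N. s x = s y → x = y`. -/
def zeroSuccAxioms : Set (hydraLang.Formula ℕ) :=
  {allN 0 ((succT (Term.var 0)).equal zeroT).not,
   allN2 0 1 (((succT (Term.var 0)).equal (succT (Term.var 1))).imp
    ((Term.var 0).equal (Term.var 1)))}

/-! ## The structure on `ℕ + ℤ` -/

/-- The universe `ℕ + ℤ`. -/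
abbrev HydraUniverse : Type := ℕ ⊕ ℤ

/-- The successor on `ℕ + ℤ`, componentwise. -/
def hydraSucc : HydraUniverse → HydraUniverse
  | Sum.inl n => Sum.inl (n + 1)
  | Sum.inr z => Sum.inr (z + 1)

/-- The union of the three paths `(0_ℕ, 0_ℤ) + r`, `(0_ℤ, 0_ℕ) + r` and `(0_ℤ - 1, 0_ℤ - 2) - r`,
where `r = {(n, 2n)}`. -/
def hydraPaths : Set (HydraUniverse × HydraUniverse) :=
  {q | ∃ n : ℕ, q = (Sum.inl n, Sum.inr (2 * (n : ℤ)))} ∪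
  {q | ∃ n : ℕ, q = (Sum.inr (n : ℤ), Sum.inl (2 * n))} ∪
  {q | ∃ n : ℕ, q = (Sum.inr (-1 - (n : ℤ)), Sum.inr (-2 - 2 * (n : ℤ)))}

/-- The structure: `N` holds everywhere and `p` is the complement of the three paths. -/
instance hydraModel : hydraLang.Structure HydraUniverse where
  funMap := fun {_} f =>
    match f with
    | HydraFunc.zero => fun _ => Sum.inl 0
    | HydraFunc.succ => fun v => hydraSucc (v 0)
  RelMap := fun {_} R =>
    match R with
    | HydraRel.N => fun _ => True
    | HydraRel.p => fun v => (v 0, v 1) ∉ hydraPaths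

end HydraID

/-!
The 2-Hydra statement has a cyclic proof with a single companion, the sequent
`H_a, H_b, H_c, H_d, N x, N y ⊢ p(x, y)` (`hydraLoop`). Case splits on `x` and `y` reduce `p(x, y)`
to the base cases in `H_a` or, by one of the other three hypotheses, to an instance of the same
sequent: `p(x', y'')` for `x = s x'`, `y = s s y''`; `p(s y'', y'')` for `x = 0`, `y = s s y''`; and
`p(s x'', x'')` for `x = s s x''`, `y = 0`. In the first case `x'` is traced to `x` and `y''` to
`y`, in the second both new arguments are traced to `y`, in the third both to `x`, and every such
trace progresses. An infinite path is a sequence of such returns, and a trace is followed backwards: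
whichever argument it is to arrive at, it has a source at the return before. As there are only two
arguments, a Kőnig argument (`exists_coherent_seq`) yields an infinite trace;
`CyclicPreProof.globalTrace_of_loop` is this principle for arbitrary inductive definitions.

Unprovability in `LKID` follows from soundness with respect to Henkin models whose Henkin class
consists of the definable sets (`LKIDProvable.sound`): the structure on `ℕ + ℤ` is such a model
(`isHenkinModel_hydra`), the `(0,s)`-axioms are true in it, and `H` is false, because `p` fails at
`(0_ℕ, 0_ℤ)`, while the paths avoid the points of `H_a`, and whenever the conclusion of an instance
of `H_b`, `H_c` or `H_d` lies on a path, so does its premise.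

The point is that a set definable with parameters that contains `0` and is closed under successor is
everything (`definable_induction`). The three paths together are the graph of an injective doubling
function `d` with `d (s x) = s (s (d x))` for `x ≠ -1_ℤ`. In an ultrapower of `ℕ + ℤ`, the infinite
elements `a = (2 ^ (2 i))_i` of `ℕ` and `b = (-2 ^ (2 i))_i` of `ℤ` are divisible by all powers of
`2`, so their orbits under `s`, `d` and the inverses are both freely parametrized by `ℤ × ℤ`. The
map that exchanges the two orbits and fixes everything else is an automorphism (`orbitSwap`); it
fixes the parameters and maps `a` to `b`. By Łoś's theorem a definable set that contains all of `ℕ`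
contains elements of `ℤ` arbitrarily far down, hence all of `ℤ` if it is closed under successor.
-/

namespace HydraID

open FirstOrder FirstOrder.Language

/-! ### Truth of formulas and soundness of `LKID` in Henkin models -/

section Semantics

variable {L : FirstOrder.Language.{0, 0}} {M : Type} [L.Structure M]

theorem realize_bind (x : ℕ) (F : L.Formula ℕ) (ρ : ℕ → M) (d : M) :
    (bind x F).Realize ρ (Fin.snoc default d) ↔ F.Realize (Function.update ρ x d) := by
  unfold bind
  rw [BoundedFormula.realize_relabel, Formula.Realize, iff_eq_eq]
  congr 1
  · funext v
    by_cases h : v = x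
    · subst h
      simp [Fin.snoc]
    · simp [h]
  · exact Subsingleton.elim _ _

@[simp]
theorem realize_allF (x : ℕ) (F : L.Formula ℕ) (ρ : ℕ → M) :
    (allF x F).Realize ρ ↔ ∀ d, F.Realize (Function.update ρ x d) :=
  forall_congr' fun d => realize_bind x F ρ d

@[simp]
theorem realize_exF (x : ℕ) (F : L.Formula ℕ) (ρ : ℕ → M) :
    (exF x F).Realize ρ ↔ ∃ d, F.Realize (Function.update ρ x d) :=
  BoundedFormula.realize_ex.trans (exists_congr fun d => realize_bind x F ρ d)

@[simp]
theorem realize_subst_formula {α β : Type} (F : L.Formula α) (θ : α → L.Term β) (ρ : β → M) :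
    Formula.Realize (BoundedFormula.subst F θ) ρ ↔ F.Realize fun v => (θ v).realize ρ :=
  BoundedFormula.realize_subst

/-- The truth of a formula depends only on the values of its free variables. -/
theorem realize_congr_freeVar {α : Type} [DecidableEq α] {F : L.Formula α} {ρ ρ' : α → M}
    (h : ∀ v ∈ F.freeVarFinset, ρ v = ρ' v) : F.Realize ρ ↔ F.Realize ρ' := by
  have h1 := BoundedFormula.realize_restrictFreeVar (φ := F) (f := id)
    (v := fun v => ρ v) (xs := (default : Fin 0 → M)) ρ (fun _ => rfl)
  have h2 := BoundedFormula.realize_restrictFreeVar (φ := F) (f := id)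
    (v := fun v => ρ v) (xs := (default : Fin 0 → M)) ρ' (fun v => h v v.2)
  exact h1.symm.trans h2

theorem realize_update_of_notMem {F : L.Formula ℕ} {x : ℕ} (hx : x ∉ F.freeVarFinset)
    (ρ : ℕ → M) (d : M) : F.Realize (Function.update ρ x d) ↔ F.Realize ρ :=
  realize_congr_freeVar fun v hv => Function.update_of_ne (by rintro rfl; exact hx hv) _ _

theorem realize_subst1 (x : ℕ) (t : L.Term ℕ) (ρ : ℕ → M) :
    (fun v => (subst1 x t v).realize ρ) = Function.update ρ x (t.realize ρ) := by
  funext v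
  by_cases h : v = x
  · subst h
    simp [subst1]
  · simp [subst1, h]

/-- A sequent holds in `M` if every valuation that makes all formulas on the left true makes some
formula on the right true. -/
def Sequent.Holds (M : Type) [L.Structure M] (s : Sequent L) : Prop :=
  ∀ ρ : ℕ → M, (∀ F ∈ s.left, F.Realize ρ) → ∃ F ∈ s.right, F.Realize ρ

theorem holds_subst {Γ Δ : Finset (L.Formula ℕ)} (h : Sequent.Holds M ⟨Γ, Δ⟩)
    (θ : ℕ → L.Term ℕ) : Sequent.Holds M ⟨substSet θ Γ, substSet θ Δ⟩ := by
  intro ρ hρ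
  obtain ⟨F, hF, hr⟩ := h (fun v => (θ v).realize ρ) fun F hF =>
    (realize_subst_formula F θ ρ).1 (hρ _ (Finset.mem_image_of_mem _ hF))
  exact ⟨_, Finset.mem_image_of_mem _ hF, (realize_subst_formula F θ ρ).2 hr⟩

/-- Exchanging two terms with equal values does not change the truth of a formula. -/
theorem realize_subst2_comm {x y : ℕ} {t u : L.Term ℕ} {ρ : ℕ → M}
    (h : t.realize ρ = u.realize ρ) (F : L.Formula ℕ) :
    Formula.Realize (BoundedFormula.subst F (subst2 x t y u)) ρ ↔
      Formula.Realize (BoundedFormula.subst F (subst2 x u y t)) ρ := by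
  rw [realize_subst_formula, realize_subst_formula, iff_eq_eq]
  congr 1
  funext v
  unfold subst2
  split_ifs <;> simp [h]

variable {S : IndSystem L}

theorem realize_atom (i : Fin S.n) (t : Fin (S.arity i) → L.Term ℕ) (ρ : ℕ → M) :
    (S.atom i t).Realize ρ ↔ Structure.RelMap (S.sym i) fun l => (t l).realize ρ :=
  Formula.realize_rel

/-- The common rules are sound in every structure whose inductive predicates are closed under the
productions. -/
theorem CommonRule.sound
    (hcl : ∀ i, S.op M (fun i => {v | Structure.RelMap (S.sym i) v}) i ⊆
      {v | Structure.RelMap (S.sym i) v})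
    (r : CommonRule S) (h : ∀ s ∈ r.prems, Sequent.Holds M s) : Sequent.Holds M r.concl := by
  cases r with
  | ax Γ Δ hne =>
    obtain ⟨F, hF⟩ := hne
    rw [Finset.mem_inter] at hF
    exact fun ρ hρ => ⟨F, hF.2, hρ F hF.1⟩
  | wk Γ Δ Γ' Δ' hΓ hΔ =>
    intro ρ hρ
    obtain ⟨F, hF, hr⟩ := h _ (List.mem_singleton_self _) ρ fun F hF => hρ F (hΓ hF)
    exact ⟨F, hΔ hF, hr⟩
  | subst Γ Δ θ => exact holds_subst (h _ (List.mem_singleton_self _)) θ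
  | eqR Γ Δ t => exact fun ρ _ => ⟨_, Finset.mem_insert_self _ _, by simp⟩
  | eqL Γ Δ x y hxy t u =>
    intro ρ hρ
    have he : t.realize ρ = u.realize ρ := by
      simpa using hρ _ (Finset.mem_insert_self _ _)
    obtain ⟨G, hG, hr⟩ := h _ (List.mem_singleton_self _) ρ (by
      intro G hG
      obtain ⟨F, hF, rfl⟩ := Finset.mem_image.1 hG
      exact (realize_subst2_comm he F).1
        (hρ _ (Finset.mem_insert_of_mem (Finset.mem_image_of_mem _ hF))))
    obtain ⟨F, hF, rfl⟩ := Finset.mem_image.1 hG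
    exact ⟨_, Finset.mem_image_of_mem _ hF, (realize_subst2_comm he F).2 hr⟩
  | intro Γ Δ i pr hpr u =>
    intro ρ hρ
    by_contra hcon
    simp only [concl, Finset.mem_insert, not_exists, not_and] at hcon
    refine hcon _ (Or.inl rfl) ((realize_atom _ _ _).2 (hcl i ⟨pr, hpr,
      fun v => (u v).realize ρ, fun q hq => ?_, fun b hb => ?_, by simp⟩))
    · obtain ⟨F, hF, hr⟩ := h _ (List.mem_append_left _ (List.mem_map_of_mem hq)) ρ hρ
      rcases Finset.mem_insert.1 hF with rfl | hF
      · simpa using hr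
      · exact absurd hr (hcon F (Or.inr hF))
    · obtain ⟨F, hF, hr⟩ := h _ (List.mem_append_right _ (List.mem_map_of_mem hb)) ρ hρ
      rcases Finset.mem_insert.1 hF with rfl | hF
      · simpa [realize_atom] using hr
      · exact absurd hr (hcon F (Or.inr hF))
  | exL Γ Δ x F hx =>
    intro ρ hρ
    obtain ⟨d, hd⟩ := (realize_exF x F ρ).1 (hρ _ (Finset.mem_insert_self _ _))
    obtain ⟨G, hG, hr⟩ := h _ (List.mem_singleton_self _) (Function.update ρ x d) (by
      intro G hG
      rcases Finset.mem_insert.1 hG with rfl | hG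
      · exact hd
      · exact (realize_update_of_notMem (fun hv => hx (Or.inl ⟨G, hG, hv⟩)) ρ d).2
          (hρ G (Finset.mem_insert_of_mem hG)))
    exact ⟨G, hG, (realize_update_of_notMem (fun hv => hx (Or.inr ⟨G, hG, hv⟩)) ρ d).1 hr⟩
  | allR Γ Δ x F hx =>
    intro ρ hρ
    by_contra hcon
    simp only [concl, Finset.mem_insert, not_exists, not_and] at hcon
    refine hcon _ (Or.inl rfl) ((realize_allF x F ρ).2 fun d => ?_)
    obtain ⟨G, hG, hr⟩ := h _ (List.mem_singleton_self _) (Function.update ρ x d)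
      fun G hG => (realize_update_of_notMem (fun hv => hx (Or.inl ⟨G, hG, hv⟩)) ρ d).2 (hρ G hG)
    rcases Finset.mem_insert.1 hG with rfl | hG
    · exact hr
    · exact absurd ((realize_update_of_notMem (fun hv => hx (Or.inr ⟨G, hG, hv⟩)) ρ d).1 hr)
        (hcon G (Or.inr hG))
  | _ =>
    -- The remaining logical rules are instances of propositional or quantifier laws at a fixed `ρ`.
    intro ρ hρ
    simp only [prems, List.mem_cons, List.not_mem_nil, or_false, forall_eq, forall_eq_or_imp,
      Sequent.Holds] at h
    try have h1 := h ρ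
    try have h1 := h.1 ρ
    try have h2 := h.2 ρ
    simp only [concl, Finset.mem_insert, forall_eq_or_imp, exists_eq_or_imp, Formula.realize_not,
      Formula.realize_sup, Formula.realize_inf, Formula.realize_imp, realize_allF, realize_exF,
      realize_subst_formula, realize_subst1] at *
    grind

variable (L M) in
theorem isHenkinClass_definableFamily : IsHenkinClass L M (definableFamily L M) where
  diag := by
    refine Set.definable_iff_exists_formula_sum.2
      ⟨Term.equal (Term.var (Sum.inr 0)) (Term.var (Sum.inr 1)), ?_⟩
    ext v
    simp
  rel k Q := by
    refine Set.definable_iff_exists_formula_sum.2 ⟨Q.formula fun l => Term.var (Sum.inr l), ?_⟩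
    ext v
    simp
  section_mem k R hR d := by
    obtain ⟨φ, rfl⟩ := Set.definable_iff_exists_formula_sum.1 hR
    refine Set.definable_iff_exists_formula_sum.2
      ⟨φ.relabel (Sum.elim Sum.inl (Fin.snoc (α := fun _ => _) Sum.inr (Sum.inl ⟨d, trivial⟩))), ?_⟩
    ext v
    simp only [Set.mem_ofPred_eq, Formula.realize_relabel]
    rw [iff_eq_eq]
    congr 1
    funext a
    rcases a with a | l
    · simp
    · refine Fin.lastCases ?_ (fun l => ?_) l <;> simp
  term k h R hR t := by
    obtain ⟨φ, rfl⟩ := Set.definable_iff_exists_formula_sum.1 hR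
    refine Set.definable_iff_exists_formula_sum.2
      ⟨BoundedFormula.subst φ (Sum.elim (fun a => Term.var (Sum.inl a))
        fun l => (t l).relabel Sum.inr), ?_⟩
    ext v
    simp only [Set.mem_ofPred_eq, realize_subst_formula]
    rw [iff_eq_eq]
    congr 1
    funext a
    rcases a with a | l <;> simp [Function.comp_def]
  compl k R hR := Set.Definable.compl hR
  inter k R₁ h₁ R₂ h₂ := Set.Definable.inter h₁ h₂
  proj k R hR := by
    have h := Set.Definable.image_comp hR (Fin.castSucc : Fin k → Fin (k + 1))
    suffices he : {v : Fin k → M | ∃ d : M, (Fin.snoc v d : Fin (k + 1) → M) ∈ R} =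
        (fun g : Fin (k + 1) → M => g ∘ Fin.castSucc) '' R from he ▸ h
    ext v
    constructor
    · rintro ⟨d, hd⟩
      exact ⟨_, hd, by funext l; simp⟩
    · rintro ⟨w, hw, rfl⟩
      refine ⟨w (Fin.last k), ?_⟩
      convert hw
      exact Fin.snoc_init_self w

/-- The sets defined by induction hypotheses are definable, with the values of the other free
variables as parameters. -/
theorem definable_realize_hyp {k : ℕ} (F : L.Formula (ℕ ⊕ Fin k)) (ρ : ℕ → M) :
    {a : Fin k → M | F.Realize (Sum.elim ρ a)} ∈ definableFamily L M k := by
  refine Set.definable_iff_exists_formula_sum.2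
    ⟨F.relabel (Sum.map (fun v => ⟨ρ v, trivial⟩) id), ?_⟩
  ext v
  simp only [Set.mem_ofPred_eq, Formula.realize_relabel]
  rw [iff_eq_eq]
  congr 1
  funext a
  rcases a with a | l <;> simp

@[simp]
theorem realize_hypInst (F : S.IndHyps) (i : Fin S.n) (t : Fin (S.arity i) → L.Term ℕ)
    (ρ : ℕ → M) :
    Formula.Realize (hypInst F i t) ρ ↔ (F i).Realize (Sum.elim ρ fun l => (t l).realize ρ) := by
  unfold hypInst
  rw [realize_subst_formula, iff_eq_eq]
  congr 1
  funext a
  rcases a with a | l <;> simp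

theorem exists_extend_of_injective {k : ℕ} {y : Fin k → ℕ} (hy : Function.Injective y)
    (ρ : ℕ → M) (a : Fin k → M) :
    ∃ ρ' : ℕ → M, (∀ l, ρ' (y l) = a l) ∧ ∀ v, v ∉ Set.range y → ρ' v = ρ v :=
  ⟨Function.extend y a ρ, fun l => hy.extend_apply a ρ l, fun _ hv =>
    Function.extend_apply' _ _ _ fun ⟨l, hl⟩ => hv ⟨l, hl⟩⟩

open Classical in
/-- The prefixed point against which the leastness of the inductive predicates is applied in the
soundness of the induction rule for `P_j`: the induction hypotheses at the predicates mutually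
dependent with `P_j`, the predicates themselves at the others on which `P_j` depends, and
everything at those on which `P_j` does not depend. -/
noncomputable def inductionTuple (F : S.IndHyps) (j : Fin S.n) (ρ : ℕ → M) (i : Fin S.n) :
    Set (Fin (S.arity i) → M) :=
  if S.MutDep i j then {a | (F i).Realize (Sum.elim ρ a)}
  else if Relation.ReflTransGen S.IsPremiseOf i j then {v | Structure.RelMap (S.sym i) v}
  else Set.univ

/-- Soundness of `LKID` in the models whose Henkin class consists of the definable sets. -/
theorem LKIDProvable.sound {Ax : Set (L.Formula ℕ)}
    (hM : IsHenkinModel S M (definableFamily L M)) (hAx : ∀ A ∈ Ax, Models M A)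
    {s : Sequent L} (h : LKIDProvable S Ax s) : Sequent.Holds M s := by
  obtain ⟨-, ⟨-, hcl⟩, hleast⟩ := hM
  induction h with
  | common r _ ih => exact r.sound hcl ih
  | given Γ Δ A hA => exact fun ρ _ => ⟨A, Finset.mem_insert_self _ _, hAx A hA ρ⟩
  | ind Γ Δ j u F y y_inj y_fresh _ _ ih_minor ih_major =>
    intro ρ hρ
    by_contra hcon
    simp only [not_exists, not_and] at hcon
    have hΓ : ∀ G ∈ Γ, G.Realize ρ := fun G hG => hρ G (Finset.mem_insert_of_mem hG)
    have key : ∀ i, {v | Structure.RelMap (S.sym i) v} ⊆ inductionTuple F j ρ i := by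
      refine hleast (show _ ∧ _ from ⟨fun i => ?_, fun i => ?_⟩)
      · unfold inductionTuple
        split_ifs
        · exact definable_realize_hyp _ _
        · exact (isHenkinClass_definableFamily L M).rel _ _
        · exact Set.definable_univ
      · rintro _ ⟨pr, hpr, σ, hord, hind, rfl⟩
        by_cases hm : S.MutDep i j
        · rw [inductionTuple, if_pos hm]
          obtain ⟨ρ', hρ'y, hρ'⟩ := exists_extend_of_injective (y_inj i pr hpr) ρ σ
          have hfv : ∀ G : L.Formula ℕ, (∀ l, y i pr l ∉ G.freeVarFinset) →
              (G.Realize ρ' ↔ G.Realize ρ) := fun G hG =>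
            realize_congr_freeVar fun v hv => hρ' v (by rintro ⟨l, rfl⟩; exact hG l hv)
          have hF : ∀ i' (a : Fin (S.arity i') → M),
              (F i').Realize (Sum.elim ρ' a) ↔ (F i').Realize (Sum.elim ρ a) := fun i' a =>
            realize_congr_freeVar fun v hv => by
              rcases v with v | v
              · exact hρ' v (by rintro ⟨l, rfl⟩; exact (y_fresh i pr hpr l).2 i' hv)
              · rfl
          have hy : ∀ t : L.Term (Fin pr.nvars), (t.relabel (y i pr)).realize ρ' = t.realize σ := by
            intro t
            rw [Term.realize_relabel]
            congr 1
            exact funext hρ'y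
          obtain ⟨G, hG, hr⟩ := ih_minor i hm pr hpr ρ' (by
            intro G hG
            simp only [minorPremise, Finset.mem_union, List.mem_toFinset, List.mem_map] at hG
            rcases hG with (hG | ⟨q, hq, rfl⟩) | ⟨b, hb, rfl⟩
            · exact (hfv G fun l hl => (y_fresh i pr hpr l).1
                (Or.inl ⟨G, Finset.mem_insert_of_mem hG, hl⟩)).2 (hΓ G hG)
            · simpa [hy] using hord q hq
            · have hb' := hind b hb
              unfold hypInstG
              unfold inductionTuple at hb'
              have hbi : S.IsPremiseOf b.1 i := ⟨pr, hpr, b, hb, rfl⟩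
              split_ifs at hb' ⊢ with h1 h2
              · simpa [hy, hF] using hb'
              · simpa [realize_atom, hy] using hb'
              · exact absurd (Relation.ReflTransGen.head hbi hm.1) h2)
          rcases Finset.mem_insert.1 hG with rfl | hG
          · simpa [hy, hF] using hr
          · exact absurd ((hfv G fun l hl => (y_fresh i pr hpr l).1 (Or.inr ⟨G, hG, hl⟩)).1 hr)
              (hcon G hG)
        · -- A predicate on which `P_j` depends, but which does not depend on `P_j`, has no premise
          -- that is mutually dependent with `P_j`, so that its own closure applies.
          by_cases hp : Relation.ReflTransGen S.IsPremiseOf i j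
          · rw [inductionTuple, if_neg hm, if_pos hp]
            refine hcl i ⟨pr, hpr, σ, hord, fun b hb => ?_, rfl⟩
            have hbi : S.IsPremiseOf b.1 i := ⟨pr, hpr, b, hb, rfl⟩
            have hb' := hind b hb
            have h1 : ¬ S.MutDep b.1 j := fun h => hm ⟨hp, h.2.tail hbi⟩
            rwa [inductionTuple, if_neg h1,
              if_pos (Relation.ReflTransGen.head hbi hp)] at hb'
          · rw [inductionTuple, if_neg hm, if_neg hp]
            exact Set.mem_univ _
    have hj := key j ((realize_atom j u ρ).1 (hρ _ (Finset.mem_insert_self _ _)))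
    rw [inductionTuple, if_pos ⟨Relation.ReflTransGen.refl, Relation.ReflTransGen.refl⟩] at hj
    obtain ⟨G, hG, hr⟩ := ih_major ρ fun G hG => by
      rcases Finset.mem_insert.1 hG with rfl | hG
      · simpa using hj
      · exact hΓ G hG
    exact hcon G hG hr

end Semantics

/-! ### The structure on `ℕ + ℤ` -/

/-- The doubling function on `ℕ + ℤ`, whose graph is the union of the three paths. -/
def hydraDouble : HydraUniverse → HydraUniverse
  | Sum.inl n => Sum.inr (2 * (n : ℤ))
  | Sum.inr z => if 0 ≤ z then Sum.inl (2 * z).toNat else Sum.inr (2 * z)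

/-- The integer underlying an element of `ℕ + ℤ`. -/
def hydraVal : HydraUniverse → ℤ
  | Sum.inl n => n
  | Sum.inr z => z

@[simp]
theorem hydraVal_double (a : HydraUniverse) : hydraVal (hydraDouble a) = 2 * hydraVal a := by
  rcases a with n | z
  · rfl
  · simp only [hydraDouble]
    split_ifs <;> simp only [hydraVal]
    omega

theorem mem_hydraPaths {a b : HydraUniverse} : (a, b) ∈ hydraPaths ↔ b = hydraDouble a := by
  simp only [hydraPaths, Set.mem_union, Set.mem_ofPred_eq, Prod.mk.injEq]
  constructor
  · rintro ((⟨n, rfl, rfl⟩ | ⟨n, rfl, rfl⟩) | ⟨n, rfl, rfl⟩)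
    · rfl
    · simp only [hydraDouble]
      rw [if_pos (by omega)]
      congr 1
    · simp only [hydraDouble]
      rw [if_neg (by omega)]
      congr 1
      omega
  · rintro rfl
    rcases a with n | z
    · exact Or.inl (Or.inl ⟨n, rfl, rfl⟩)
    · simp only [hydraDouble]
      split_ifs with h
      · exact Or.inl (Or.inr ⟨z.toNat, by simp [h], by congr 1; omega⟩)
      · exact Or.inr ⟨(-1 - z).toNat, by congr 1; omega, by congr 1; omega⟩

theorem hydraDouble_injective : Function.Injective hydraDouble := by
  intro a b h
  have hv : hydraVal a = hydraVal b := by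
    have := congrArg hydraVal h
    simp only [hydraVal_double] at this
    omega
  rcases a with n | z <;> rcases b with m | w <;> simp only [hydraVal] at hv
  · congr 1
    omega
  · subst hv
    simp [hydraDouble] at h
  · subst hv
    simp [hydraDouble] at h
  · congr 1

theorem hydraSucc_injective : Function.Injective hydraSucc := by
  intro a b h
  rcases a with n | z <;> rcases b with m | w <;> simp_all [hydraSucc]

section Truth

@[simp]
theorem realize_zeroT {V : Type} (ρ : V → HydraUniverse) :
    (zeroT : hydraLang.Term V).realize ρ = Sum.inl 0 := rfl

@[simp]
theorem realize_succT {V : Type} (t : hydraLang.Term V) (ρ : V → HydraUniverse) :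
    (succT t).realize ρ = hydraSucc (t.realize ρ) := rfl

@[simp]
theorem realize_natF (t : hydraLang.Term ℕ) (ρ : ℕ → HydraUniverse) :
    (natF t).Realize ρ := trivial

@[simp]
theorem realize_pF (t u : hydraLang.Term ℕ) (ρ : ℕ → HydraUniverse) :
    (pF t u).Realize ρ ↔ u.realize ρ ≠ hydraDouble (t.realize ρ) := by
  rw [Ne, ← mem_hydraPaths]
  exact Formula.realize_rel

@[simp]
theorem realize_allN (x : ℕ) (F : hydraLang.Formula ℕ) (ρ : ℕ → HydraUniverse) :
    (allN x F).Realize ρ ↔ ∀ d, F.Realize (Function.update ρ x d) := by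
  simp [allN]

@[simp]
theorem realize_allN2 (x y : ℕ) (F : hydraLang.Formula ℕ) (ρ : ℕ → HydraUniverse) :
    (allN2 x y F).Realize ρ ↔
      ∀ d e, F.Realize (Function.update (Function.update ρ x d) y e) := by
  simp [allN2]

theorem models_zeroSuccAxioms : ∀ A ∈ zeroSuccAxioms, Models HydraUniverse A := by
  rintro A (rfl | rfl) ρ
  · simp only [realize_allN, Formula.realize_not, Formula.realize_equal]
    intro d
    rcases d with n | z <;> simp [hydraSucc]
  · simp only [realize_allN2, Formula.realize_imp, Formula.realize_equal]
    intro d e h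
    simpa using hydraSucc_injective (by simpa using h)

theorem not_models_hydraH : ¬ Models HydraUniverse hydraH := by
  intro h
  have h := h fun _ => Sum.inl 0
  simp only [hydraH, Ha, Hb, Hc, Hd, Formula.realize_imp, Formula.realize_inf, realize_allN,
    realize_allN2, realize_pF, realize_zeroT, realize_succT, Term.realize_var,
    Function.update_self, ne_eq, Function.update_of_ne, zero_ne_one, not_false_eq_true] at h
  refine h ⟨fun d => ⟨?_, ?_, ?_⟩, fun d e hd he => hd ?_, fun d hd he => hd ?_,
    fun d hd he => hd ?_⟩ (Sum.inl 0) (Sum.inr 0) rfl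
  · simp [hydraDouble]
  · simp [hydraDouble, hydraSucc]
  · rcases d with n | z
    · simp [hydraDouble, hydraSucc]
    · simp only [hydraDouble, hydraSucc]
      split_ifs
      · simp only [Sum.inl.injEq]
        omega
      · simp
  · rcases d with n | z <;> rcases e with m | w <;>
      simp only [hydraDouble, hydraSucc] at he ⊢ <;> grind
  · rcases d with n | z <;>
      simp only [hydraDouble, hydraSucc, Sum.inr.injEq, reduceCtorEq] at he ⊢
    obtain rfl : z = -2 := by simpa using (by omega : z = -2)
    simp
  · rcases d with n | z <;> simp only [hydraDouble, hydraSucc] at he ⊢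
    · simp at he
    · split_ifs at he ⊢ <;> simp only [Sum.inl.injEq, Sum.inr.injEq] at he ⊢ <;> omega

end Truth

section Swap

variable {U I : Type} {A B : I → U}

/-- The map that exchanges `A i` and `B i` for every `i` and fixes everything else. -/
noncomputable def swapFamilies (A B : I → U) : U → U :=
  Function.extend A B (Function.extend B A id)

theorem swapFamilies_left (hA : Function.Injective A) (i : I) : swapFamilies A B (A i) = B i :=
  hA.extend_apply _ _ _

theorem swapFamilies_right (hB : Function.Injective B) (hAB : ∀ i j, A i ≠ B j) (i : I) :
    swapFamilies A B (B i) = A i := by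
  rw [swapFamilies, Function.extend_apply' _ _ _ fun ⟨j, hj⟩ => hAB j i hj, hB.extend_apply]

theorem swapFamilies_other {x : U} (hA : ∀ i, A i ≠ x) (hB : ∀ i, B i ≠ x) :
    swapFamilies A B x = x := by
  rw [swapFamilies, Function.extend_apply' _ _ _ fun ⟨j, hj⟩ => hA j hj,
    Function.extend_apply' _ _ _ fun ⟨j, hj⟩ => hB j hj, id]

theorem swapFamilies_involutive (hA : Function.Injective A) (hB : Function.Injective B)
    (hAB : ∀ i j, A i ≠ B j) : Function.Involutive (swapFamilies A B) := by
  intro x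
  by_cases h1 : ∃ i, A i = x
  · obtain ⟨i, rfl⟩ := h1
    rw [swapFamilies_left hA, swapFamilies_right hB hAB]
  by_cases h2 : ∃ i, B i = x
  · obtain ⟨i, rfl⟩ := h2
    rw [swapFamilies_right hB hAB, swapFamilies_left hA]
  · push Not at h1 h2
    rw [swapFamilies_other h1 h2, swapFamilies_other h1 h2]

/-- The exchange of two families commutes with every map that acts on their indices in the same way
and under which both families are closed under preimages. -/
theorem swapFamilies_comm (hA : Function.Injective A) (hB : Function.Injective B)
    (hAB : ∀ i j, A i ≠ B j) {g : U → U} {γ : I → I} (gA : ∀ i, g (A i) = A (γ i))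
    (gB : ∀ i, g (B i) = B (γ i)) (gA' : ∀ x i, g x = A i → ∃ j, A j = x)
    (gB' : ∀ x i, g x = B i → ∃ j, B j = x) (x : U) :
    swapFamilies A B (g x) = g (swapFamilies A B x) := by
  by_cases h1 : ∃ i, A i = x
  · obtain ⟨i, rfl⟩ := h1
    rw [gA, swapFamilies_left hA, swapFamilies_left hA, gB]
  by_cases h2 : ∃ i, B i = x
  · obtain ⟨i, rfl⟩ := h2
    rw [gB, swapFamilies_right hB hAB, swapFamilies_right hB hAB, gA]
  rw [swapFamilies_other (fun i hi => h1 (gA' x i hi.symm)) (fun i hi => h2 (gB' x i hi.symm)),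
    swapFamilies_other (fun i hi => h1 ⟨i, hi⟩) (fun i hi => h2 ⟨i, hi⟩)]

end Swap

/-! ### Definable induction on `ℕ + ℤ` by an automorphism of an ultrapower -/

section Ultrapower

open Filter

/-- The ultrapower of `ℕ + ℤ` by a nonprincipal ultrafilter on `ℕ`. -/
abbrev HydraUltra : Type :=
  ((hyperfilter ℕ : Ultrafilter ℕ) : Filter ℕ).Product fun _ => HydraUniverse

/-- The element of the ultrapower represented by a sequence. -/
noncomputable def ultraMk (x : ℕ → HydraUniverse) : HydraUltra :=
  @Quotient.mk' _ (productSetoid _ _) x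

theorem ultraMk_eq {x y : ℕ → HydraUniverse} :
    ultraMk x = ultraMk y ↔ ∀ᶠ i : ℕ in (hyperfilter ℕ : Filter ℕ), x i = y i :=
  Quotient.eq'' (s₁ := productSetoid _ _)

theorem ultraMk_surjective : Function.Surjective ultraMk :=
  Quotient.mk'_surjective (s := productSetoid _ _)

/-- The coordinatewise extension of a map to the ultrapower. -/
noncomputable def ultraMap (g : HydraUniverse → HydraUniverse) : HydraUltra → HydraUltra :=
  Quotient.map (sa := productSetoid _ _) (sb := productSetoid _ _) (fun x i => g (x i))
    fun _ _ h => Eventually.mono h fun _ hi => congrArg g hi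

theorem ultraMap_mk (g : HydraUniverse → HydraUniverse) (x : ℕ → HydraUniverse) :
    ultraMap g (ultraMk x) = ultraMk fun i => g (x i) := rfl

theorem ultraMap_injective {g : HydraUniverse → HydraUniverse} (hg : Function.Injective g) :
    Function.Injective (ultraMap g) := by
  intro a b h
  obtain ⟨x, rfl⟩ := ultraMk_surjective a
  obtain ⟨y, rfl⟩ := ultraMk_surjective b
  rw [ultraMap_mk, ultraMap_mk, ultraMk_eq] at h
  exact ultraMk_eq.2 (h.mono fun i hi => hg hi)

theorem ultra_funMap_zero (v : Fin 0 → HydraUltra) :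
    (Structure.funMap (L := hydraLang) HydraFunc.zero v : HydraUltra) =
      ultraMk fun _ => Sum.inl 0 := by
  have h := Ultraproduct.funMap_cast (L := hydraLang) (u := hyperfilter ℕ)
    (M := fun _ => HydraUniverse) HydraFunc.zero (fun i : Fin 0 => i.elim0)
  rw [Subsingleton.elim v]
  exact h

theorem ultra_funMap_succ (v : Fin 1 → HydraUltra) :
    (Structure.funMap (L := hydraLang) HydraFunc.succ v : HydraUltra) =
      ultraMap hydraSucc (v 0) := by
  obtain ⟨x, hx⟩ := ultraMk_surjective (v 0)
  have h := Ultraproduct.funMap_cast (L := hydraLang) (u := hyperfilter ℕ)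
    (M := fun _ => HydraUniverse) HydraFunc.succ (fun _ : Fin 1 => x)
  have hv : v = fun _ => ultraMk x := by
    funext i
    rw [Subsingleton.elim i 0, hx]
  subst hv
  exact h

theorem ultra_relMap {k : ℕ} (R : hydraLang.Relations k) (x : Fin k → ℕ → HydraUniverse) :
    Structure.RelMap R (fun l => ultraMk (x l)) ↔
      ∀ᶠ i : ℕ in (hyperfilter ℕ : Filter ℕ), Structure.RelMap R fun l => x l i := by
  have h := Ultraproduct.realize_formula_cast (u := hyperfilter ℕ)
    (M := fun _ => HydraUniverse) (R.formula fun l => Term.var l) x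
  rw [Formula.realize_rel] at h
  exact h.trans (eventually_congr (Eventually.of_forall fun i => Formula.realize_rel))

theorem ultra_relMap_N (v : Fin 1 → HydraUltra) :
    Structure.RelMap (L := hydraLang) HydraRel.N v := by
  choose x hx using fun l => ultraMk_surjective (v l)
  rw [← funext hx, ultra_relMap]
  exact Eventually.of_forall fun _ => trivial

theorem ultra_relMap_p (v : Fin 2 → HydraUltra) :
    Structure.RelMap (L := hydraLang) HydraRel.p v ↔ v 1 ≠ ultraMap hydraDouble (v 0) := by
  choose x hx using fun l => ultraMk_surjective (v l)
  rw [← funext hx, ultra_relMap, ultraMap_mk, Ne, ultraMk_eq, ← Ultrafilter.eventually_not]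
  exact eventually_congr (Eventually.of_forall fun i => not_congr mem_hydraPaths)

/-- A bijection of the ultrapower that commutes with `0`, successor and doubling is an
automorphism. -/
def ultraAut (e : HydraUltra ≃ HydraUltra)
    (h0 : e (ultraMk fun _ => Sum.inl 0) = ultraMk fun _ => Sum.inl 0)
    (hs : ∀ x, e (ultraMap hydraSucc x) = ultraMap hydraSucc (e x))
    (hd : ∀ x, e (ultraMap hydraDouble x) = ultraMap hydraDouble (e x)) :
    HydraUltra ≃[hydraLang] HydraUltra where
  toEquiv := e
  map_fun' := by
    rintro n (_ | _) x
    · exact (congrArg e (ultra_funMap_zero x)).trans (h0.trans (ultra_funMap_zero _).symm)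
    · exact (congrArg e (ultra_funMap_succ x)).trans
        ((hs _).trans (ultra_funMap_succ (e ∘ x)).symm)
  map_rel' := by
    rintro n (_ | _) x
    · exact iff_of_true (ultra_relMap_N _) (ultra_relMap_N _)
    · refine (ultra_relMap_p _).trans (Iff.trans ?_ (ultra_relMap_p _).symm)
      simp only [Function.comp_apply]
      exact not_congr ((hd _).symm ▸ e.injective.eq_iff)

end Ultrapower

section Components

open Filter

/-- The integer `2 ^ (2 i + j)`, with exponents truncated at `0`. -/
def twoPow (j : ℤ) (i : ℕ) : ℤ := 2 ^ (2 * (i : ℤ) + j).toNat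

theorem eventually_lt_twoPow (j k : ℤ) :
    ∀ᶠ i : ℕ in (hyperfilter ℕ : Filter ℕ), 0 ≤ 2 * (i : ℤ) + j ∧ k < twoPow j i := by
  refine Nat.hyperfilter_le_atTop ((eventually_ge_atTop (j.natAbs + k.natAbs)).mono fun i hi => ?_)
  refine ⟨by omega, ?_⟩
  have h1 : k.natAbs ≤ (2 * (i : ℤ) + j).toNat := by omega
  have h2 : k.natAbs < 2 ^ (2 * (i : ℤ) + j).toNat := h1.trans_lt Nat.lt_two_pow_self
  have h3 : (k.natAbs : ℤ) < twoPow j i := by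
    unfold twoPow
    exact_mod_cast h2
  omega

theorem twoPow_add_one {j : ℤ} {i : ℕ} (h : 0 ≤ 2 * (i : ℤ) + j) :
    twoPow (j + 1) i = 2 * twoPow j i := by
  unfold twoPow
  rw [← pow_succ', show (2 * (i : ℤ) + (j + 1)).toNat = (2 * (i : ℤ) + j).toNat + 1 by omega]

theorem twoPow_mono {j j' : ℤ} (h : j ≤ j') (i : ℕ) : twoPow j i ≤ twoPow j' i :=
  pow_le_pow_right₀ (by norm_num) (by omega)

/-- Eventually `2 ^ (2 i + j) + k` determines `j` and `k`. -/
theorem twoPow_inj {j k j' k' : ℤ}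
    (h : ∀ᶠ i : ℕ in (hyperfilter ℕ : Filter ℕ), twoPow j i + k = twoPow j' i + k') :
    j = j' ∧ k = k' := by
  have key : ∀ {j k j' k' : ℤ}, j < j' →
      ¬ ∀ᶠ i : ℕ in (hyperfilter ℕ : Filter ℕ), twoPow j i + k = twoPow j' i + k' := by
    intro j k j' k' hj h
    obtain ⟨i, hi, h0, hlt⟩ := (h.and (eventually_lt_twoPow j (k - k'))).exists
    have h1 := twoPow_mono (show j + 1 ≤ j' by omega) i
    rw [twoPow_add_one h0] at h1
    omega
  rcases lt_trichotomy j j' with hj | rfl | hj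
  · exact (key hj h).elim
  · obtain ⟨i, hi⟩ := h.exists
    exact ⟨rfl, by omega⟩
  · exact (key hj (h.mono fun _ => Eq.symm)).elim

open Classical in
/-- The orbit under successor and doubling, and their inverses, of the infinite element
`(2 ^ (2 i))_i` of the summand `ℕ`. Doubling alternates between the two summands. -/
noncomputable def posOrbit (q : ℤ × ℤ) : HydraUltra :=
  ultraMk fun i => if Even q.1 then Sum.inl (twoPow q.1 i + q.2).toNat
    else Sum.inr (twoPow q.1 i + q.2)

/-- The orbit under successor and doubling, and their inverses, of the infinite element
`(-2 ^ (2 i))_i` of the summand `ℤ`. -/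
noncomputable def negOrbit (q : ℤ × ℤ) : HydraUltra :=
  ultraMk fun i => Sum.inr (-twoPow q.1 i + q.2)

theorem val_posOrbit (q : ℤ × ℤ) {x : ℕ → HydraUniverse} (h : posOrbit q = ultraMk x) :
    ∀ᶠ i : ℕ in (hyperfilter ℕ : Filter ℕ), hydraVal (x i) = twoPow q.1 i + q.2 := by
  filter_upwards [ultraMk_eq.1 h, eventually_lt_twoPow q.1 (-q.2)] with i hi hp
  rw [← hi]
  split_ifs
  · simp only [hydraVal]
    omega
  · rfl

theorem val_negOrbit (q : ℤ × ℤ) {x : ℕ → HydraUniverse} (h : negOrbit q = ultraMk x) :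
    ∀ᶠ i : ℕ in (hyperfilter ℕ : Filter ℕ), hydraVal (x i) = -twoPow q.1 i + q.2 := by
  filter_upwards [ultraMk_eq.1 h] with i hi
  rw [← hi]
  rfl

theorem posOrbit_injective : Function.Injective posOrbit := by
  rintro ⟨j, k⟩ ⟨j', k'⟩ h
  obtain ⟨x, hx⟩ := ultraMk_surjective (posOrbit (j, k))
  obtain ⟨h1, h2⟩ := twoPow_inj (((val_posOrbit _ hx.symm).and
    (val_posOrbit _ (h.symm.trans hx.symm))).mono fun i hi => hi.1.symm.trans hi.2)
  exact Prod.ext h1 h2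

theorem negOrbit_injective : Function.Injective negOrbit := by
  rintro ⟨j, k⟩ ⟨j', k'⟩ h
  obtain ⟨x, hx⟩ := ultraMk_surjective (negOrbit (j, k))
  obtain ⟨h1, h2⟩ := twoPow_inj (j := j) (k := -k) (j' := j') (k' := -k')
    (((val_negOrbit _ hx.symm).and (val_negOrbit _ (h.symm.trans hx.symm))).mono fun i hi => by
      have := hi.1.symm.trans hi.2
      simp only at this
      omega)
  exact Prod.ext h1 (neg_injective h2)

theorem posOrbit_ne_negOrbit (q q' : ℤ × ℤ) : posOrbit q ≠ negOrbit q' := by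
  intro h
  obtain ⟨x, hx⟩ := ultraMk_surjective (posOrbit q)
  obtain ⟨i, ⟨h1, h2⟩, h3, h4⟩ := (((val_posOrbit _ hx.symm).and
    (val_negOrbit _ (h.symm.trans hx.symm))).and ((eventually_lt_twoPow q.1 (-q.2)).and
      (eventually_lt_twoPow q'.1 q'.2))).exists
  omega

theorem posOrbit_ne_const (q : ℤ × ℤ) (c : HydraUniverse) : posOrbit q ≠ ultraMk fun _ => c := by
  intro h
  obtain ⟨i, h1, h2⟩ := ((val_posOrbit _ h).and
    (eventually_lt_twoPow q.1 (hydraVal c - q.2))).exists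
  omega

theorem negOrbit_ne_const (q : ℤ × ℤ) (c : HydraUniverse) : negOrbit q ≠ ultraMk fun _ => c := by
  intro h
  obtain ⟨i, h1, h2⟩ := ((val_negOrbit _ h).and
    (eventually_lt_twoPow q.1 (q.2 - hydraVal c))).exists
  omega

theorem succ_posOrbit (j k : ℤ) : ultraMap hydraSucc (posOrbit (j, k)) = posOrbit (j, k + 1) := by
  refine ultraMk_eq.2 ((eventually_lt_twoPow j (-k)).mono fun i hi => ?_)
  simp only
  split_ifs <;> simp only [hydraSucc, Sum.inl.injEq, Sum.inr.injEq] <;> omega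

theorem succ_negOrbit (j k : ℤ) : ultraMap hydraSucc (negOrbit (j, k)) = negOrbit (j, k + 1) := by
  refine ultraMk_eq.2 (Eventually.of_forall fun i => ?_)
  simp only [hydraSucc, Sum.inr.injEq]
  omega

theorem double_posOrbit (j k : ℤ) :
    ultraMap hydraDouble (posOrbit (j, k)) = posOrbit (j + 1, 2 * k) := by
  refine ultraMk_eq.2 ((eventually_lt_twoPow j (-k)).mono fun i hi => ?_)
  simp only [twoPow_add_one hi.1, Int.even_add_one]
  by_cases h : Even j
  · simp only [h, hydraDouble, not_true_eq_false, if_true, if_false, Sum.inr.injEq]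
    omega
  · simp only [h, hydraDouble, not_false_eq_true, if_true, if_false]
    rw [if_pos (by omega)]
    simp only [Sum.inl.injEq]
    omega

theorem double_negOrbit (j k : ℤ) :
    ultraMap hydraDouble (negOrbit (j, k)) = negOrbit (j + 1, 2 * k) := by
  refine ultraMk_eq.2 ((eventually_lt_twoPow j k).mono fun i hi => ?_)
  simp only [twoPow_add_one hi.1, hydraDouble]
  rw [if_neg (by omega)]
  simp only [Sum.inr.injEq]
  omega

/-- Twice an integer differs from `2 ^ (2 i + j)`, which is eventually even, by an even number. -/
theorem even_of_eventually_double {j k : ℤ} {x : ℕ → HydraUniverse}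
    (h : ∀ᶠ i : ℕ in (hyperfilter ℕ : Filter ℕ), hydraVal (hydraDouble (x i)) = twoPow j i + k) :
    Even k := by
  obtain ⟨i, h1, h2, -⟩ := (h.and (eventually_lt_twoPow (j - 1) 0)).exists
  have h3 := twoPow_add_one h2
  rw [sub_add_cancel] at h3
  rw [hydraVal_double] at h1
  exact ⟨hydraVal (x i) - twoPow (j - 1) i, by omega⟩

theorem mem_posOrbit_of_double {x : HydraUltra} {q : ℤ × ℤ}
    (h : ultraMap hydraDouble x = posOrbit q) : ∃ q', posOrbit q' = x := by
  obtain ⟨j, k⟩ := q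
  obtain ⟨x, rfl⟩ := ultraMk_surjective x
  obtain ⟨m, rfl⟩ := (even_of_eventually_double (val_posOrbit _ h.symm)).two_dvd
  refine ⟨(j - 1, m), ultraMap_injective hydraDouble_injective ?_⟩
  rw [double_posOrbit, sub_add_cancel, h]

theorem mem_negOrbit_of_double {x : HydraUltra} {q : ℤ × ℤ}
    (h : ultraMap hydraDouble x = negOrbit q) : ∃ q', negOrbit q' = x := by
  obtain ⟨j, k⟩ := q
  obtain ⟨x, rfl⟩ := ultraMk_surjective x
  have hk : Even k := by
    obtain ⟨i, h1, h2, -⟩ := ((val_negOrbit _ h.symm).and (eventually_lt_twoPow (j - 1) 0)).exists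
    have h3 := twoPow_add_one h2
    rw [sub_add_cancel] at h3
    rw [hydraVal_double] at h1
    exact ⟨hydraVal (x i) + twoPow (j - 1) i, by simp only at h1; omega⟩
  obtain ⟨m, rfl⟩ := hk.two_dvd
  refine ⟨(j - 1, m), ultraMap_injective hydraDouble_injective ?_⟩
  rw [double_negOrbit, sub_add_cancel, h]

/-- The automorphism of the ultrapower that exchanges the two orbits. It fixes the elements of the
original structure. -/
noncomputable def orbitSwap : HydraUltra ≃[hydraLang] HydraUltra :=
  ultraAut (swapFamilies_involutive posOrbit_injective negOrbit_injective
      posOrbit_ne_negOrbit).toPerm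
    (swapFamilies_other (fun q => posOrbit_ne_const q _) fun q => negOrbit_ne_const q _)
    (swapFamilies_comm posOrbit_injective negOrbit_injective posOrbit_ne_negOrbit
      (γ := fun q => (q.1, q.2 + 1)) (fun q => succ_posOrbit q.1 q.2)
      (fun q => succ_negOrbit q.1 q.2)
      (fun x q h => ⟨(q.1, q.2 - 1), ultraMap_injective hydraSucc_injective
        (by rw [succ_posOrbit, sub_add_cancel, h])⟩)
      (fun x q h => ⟨(q.1, q.2 - 1), ultraMap_injective hydraSucc_injective
        (by rw [succ_negOrbit, sub_add_cancel, h])⟩))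
    (swapFamilies_comm posOrbit_injective negOrbit_injective posOrbit_ne_negOrbit
      (γ := fun q => (q.1 + 1, 2 * q.2)) (fun q => double_posOrbit q.1 q.2)
      (fun q => double_negOrbit q.1 q.2) (fun _ _ => mem_posOrbit_of_double)
      (fun _ _ => mem_negOrbit_of_double))

theorem orbitSwap_const (c : HydraUniverse) :
    orbitSwap (ultraMk fun _ => c) = ultraMk fun _ => c :=
  swapFamilies_other (fun q => posOrbit_ne_const q c) fun q => negOrbit_ne_const q c

theorem orbitSwap_posOrbit (q : ℤ × ℤ) : orbitSwap (posOrbit q) = negOrbit q :=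
  swapFamilies_left posOrbit_injective q

/-- A set definable with parameters that contains almost all the elements `2 ^ (2 i)` of `ℕ`
contains almost all the elements `-2 ^ (2 i)` of `ℤ`. -/
theorem definable_transfer {D : Set (Fin 1 → HydraUniverse)}
    (hD : (Set.univ : Set HydraUniverse).Definable hydraLang D)
    (h : ∀ᶠ i : ℕ in (hyperfilter ℕ : Filter ℕ), (fun _ => Sum.inl (twoPow 0 i + 0).toNat) ∈ D) :
    ∀ᶠ i : ℕ in (hyperfilter ℕ : Filter ℕ), (fun _ => Sum.inr (-twoPow 0 i + 0)) ∈ D := by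
  obtain ⟨φ, rfl⟩ := Set.definable_iff_exists_formula_sum.1 hD
  -- Łoś's theorem for `φ` at the parameters of `D` and the element represented by `z`.
  have los : ∀ z : ℕ → HydraUniverse,
      φ.Realize (Sum.elim (fun c : (Set.univ : Set HydraUniverse) => ultraMk fun _ => c)
        fun _ : Fin 1 => ultraMk z) ↔
      ∀ᶠ i : ℕ in (hyperfilter ℕ : Filter ℕ), (fun _ : Fin 1 => z i) ∈
        {v : Fin 1 → HydraUniverse | φ.Realize (Sum.elim (↑) v)} := by
    intro z
    have h1 := Ultraproduct.realize_formula_cast (u := hyperfilter ℕ)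
      (M := fun _ => HydraUniverse) φ (Sum.elim (fun c _ => (c : HydraUniverse)) fun _ => z)
    refine Iff.trans (iff_of_eq ?_) (h1.trans (eventually_congr (Eventually.of_forall fun i =>
      iff_of_eq ?_)))
    · congr 1
      funext a
      rcases a with a | a <;> rfl
    · refine congrArg φ.Realize ?_
      funext a
      rcases a with a | a <;> rfl
  have hp : posOrbit (0, 0) = ultraMk fun i => Sum.inl (twoPow 0 i + 0).toNat := by
    simp [posOrbit]
  have h1 := (los _).2 h
  rw [← hp, ← StrongHomClass.realize_formula orbitSwap] at h1
  refine (los _).1 ((iff_of_eq (congrArg φ.Realize ?_)).1 h1)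
  funext a
  rcases a with a | a
  · exact orbitSwap_const _
  · exact orbitSwap_posOrbit _

/-- A set that is definable with parameters, contains `0`, and is closed under successor is the
whole of `ℕ + ℤ`. -/
theorem definable_induction {D : Set (Fin 1 → HydraUniverse)}
    (hD : (Set.univ : Set HydraUniverse).Definable hydraLang D)
    (h0 : (fun _ => Sum.inl 0) ∈ D) (hs : ∀ a, (fun _ => a) ∈ D → (fun _ => hydraSucc a) ∈ D)
    (v : Fin 1 → HydraUniverse) : v ∈ D := by
  have hN : ∀ n : ℕ, (fun _ => Sum.inl n) ∈ D := fun n => by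
    induction n with
    | zero => exact h0
    | succ n ih => exact hs _ ih
  have hup : ∀ (z : ℤ) (m : ℕ), (fun _ => Sum.inr z) ∈ D → (fun _ => Sum.inr (z + m)) ∈ D := by
    intro z m hz
    induction m with
    | zero => simpa using hz
    | succ m ih =>
      have := hs _ ih
      simpa [hydraSucc, add_assoc] using this
  have hv : v = fun _ => v 0 := by
    funext i
    rw [Subsingleton.elim i 0]
  rw [hv]
  rcases v 0 with n | z
  · exact hN n
  · obtain ⟨i, h1, -, h2⟩ := ((definable_transfer hD (Eventually.of_forall fun i => hN _)).and
      (eventually_lt_twoPow 0 (-z))).exists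
    have h3 := hup _ (z + twoPow 0 i).toNat h1
    rwa [show -twoPow 0 i + 0 + ((z + twoPow 0 i).toNat : ℤ) = z by omega] at h3

theorem isHenkinModel_hydra :
    IsHenkinModel hydraSystem HydraUniverse (definableFamily hydraLang HydraUniverse) := by
  refine ⟨isHenkinClass_definableFamily _ _, ⟨fun i => ?_, fun i v _ => trivial⟩, ?_⟩
  · exact (isHenkinClass_definableFamily hydraLang HydraUniverse).rel 1 HydraRel.N
  · rintro X ⟨hX, hcl⟩ i v -
    refine definable_induction (hX i) (hcl i ⟨zeroProd i, by simp, fun l => l.elim0,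
      fun q hq => absurd hq List.not_mem_nil,
      fun b hb => absurd hb List.not_mem_nil, rfl⟩) (fun a ha => ?_) v
    refine hcl i ⟨succProd i, by simp, fun _ => a,
      fun q hq => absurd hq List.not_mem_nil, ?_, rfl⟩
    intro b hb
    obtain rfl := List.mem_singleton.1 hb
    exact ha

theorem not_LKIDProvable_hydraH : ¬ LKIDProvable hydraSystem zeroSuccAxioms ⟨∅, {hydraH}⟩ := by
  intro h
  refine not_models_hydraH fun ρ => ?_
  obtain ⟨F, hF, hr⟩ := h.sound isHenkinModel_hydra models_zeroSuccAxioms ρ (by simp)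
  rwa [Finset.mem_singleton.1 hF] at hr

end Components

/-! ### Traces in cyclic pre-proofs whose buds share one companion -/

section Cyclic

variable {L : FirstOrder.Language.{0, 0}} {S : IndSystem L}

/-- `T.Trace q b τ τ'`: in the tree `T` there is a trace along the branch `q`, from `τ` at the root
to `τ'` at the address `q`. If `b` is true, the trace has a progress point. -/
inductive DTree.Trace : DTree S → List ℕ → Bool → L.Formula ℕ → L.Formula ℕ → Prop
  | nil (T : DTree S) (τ : L.Formula ℕ) : Trace T [] false τ τ
  | step (r : OmegaRule S) (ch : Fin r.prems.length → DTree S) (i : ℕ) (hi : i < r.prems.length)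
      (q : List ℕ) (b : Bool) (τ τ₁ τ' : L.Formula ℕ) (hatom : ∃ j t, τ = S.atom j t)
      (hmem : τ ∈ r.concl.left) (hstep : r.TraceStep i τ τ₁) (h : Trace (ch ⟨i, hi⟩) q b τ₁ τ') :
      Trace (.node r ch) (i :: q) b τ τ'
  | progress (r : OmegaRule S) (ch : Fin r.prems.length → DTree S) (i : ℕ)
      (hi : i < r.prems.length) (q : List ℕ) (b : Bool) (τ τ₁ τ' : L.Formula ℕ)
      (hatom : ∃ j t, τ = S.atom j t) (hmem : τ ∈ r.concl.left) (hprog : r.Progress i τ τ₁)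
      (h : Trace (ch ⟨i, hi⟩) q b τ₁ τ') : Trace (.node r ch) (i :: q) true τ τ'

theorem OmegaRule.Progress.traceStep {r : OmegaRule S} {i : ℕ} {τ τ' : L.Formula ℕ}
    (h : r.Progress i τ τ') : r.TraceStep i τ τ' := by
  cases r with
  | common r => exact h.elim
  | case Γ Δ j u y h1 h2 => exact Or.inr h

/-- A trace along a branch, listed formula by formula. -/
theorem DTree.Trace.exists_fun {T : DTree S} {q : List ℕ} {b : Bool} {τ τ' : L.Formula ℕ}
    (h : T.Trace q b τ τ') : ∃ f : ℕ → L.Formula ℕ, f 0 = τ ∧ f q.length = τ' ∧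
      (∀ q₁ i, q₁ ++ [i] <+: q → ∃ r ch, T.sub q₁ = some (.node r ch) ∧
        (∃ j t, f q₁.length = S.atom j t) ∧ f q₁.length ∈ r.concl.left ∧
        r.TraceStep i (f q₁.length) (f (q₁.length + 1))) ∧
      (b = true → ∃ q₁ i r ch, q₁ ++ [i] <+: q ∧ T.sub q₁ = some (.node r ch) ∧
        r.Progress i (f q₁.length) (f (q₁.length + 1))) := by
  have aux : ∀ (r : OmegaRule S) (ch : Fin r.prems.length → DTree S) (i : ℕ)
      (hi : i < r.prems.length) (q : List ℕ) (τ τ₁ : L.Formula ℕ) (f : ℕ → L.Formula ℕ),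
      (∃ j t, τ = S.atom j t) → τ ∈ r.concl.left → r.TraceStep i τ τ₁ → f 0 = τ₁ →
      (∀ q₁ i', q₁ ++ [i'] <+: q → ∃ r' ch', (ch ⟨i, hi⟩).sub q₁ = some (.node r' ch') ∧
        (∃ j t, f q₁.length = S.atom j t) ∧ f q₁.length ∈ r'.concl.left ∧
        r'.TraceStep i' (f q₁.length) (f (q₁.length + 1))) →
      ∀ q₁ i', q₁ ++ [i'] <+: i :: q → ∃ r' ch',
        (DTree.node r ch).sub q₁ = some (.node r' ch') ∧
        (∃ j t, (fun n => Nat.casesOn n τ f : ℕ → L.Formula ℕ) q₁.length = S.atom j t) ∧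
        (fun n => Nat.casesOn n τ f : ℕ → L.Formula ℕ) q₁.length ∈ r'.concl.left ∧
        r'.TraceStep i' ((fun n => Nat.casesOn n τ f : ℕ → L.Formula ℕ) q₁.length)
          ((fun n => Nat.casesOn n τ f : ℕ → L.Formula ℕ) (q₁.length + 1)) := by
    intro r ch i hi q τ τ₁ f hatom hmem hstep hf0 hf q₁ i' hq
    cases q₁ with
    | nil =>
      obtain ⟨rfl, -⟩ := List.cons_prefix_cons.1 hq
      refine ⟨r, ch, rfl, hatom, hmem, ?_⟩
      simpa [hf0] using hstep
    | cons i'' q₁ =>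
      obtain ⟨rfl, hq'⟩ := List.cons_prefix_cons.1 hq
      obtain ⟨r', ch', h1, h2⟩ := hf q₁ i' hq'
      exact ⟨r', ch', by simp [DTree.sub, hi, h1], h2⟩
  induction h with
  | nil T τ =>
    refine ⟨fun _ => τ, rfl, rfl, fun q₁ i h => ?_, by simp⟩
    simp at h
  | step r ch i hi q b τ τ₁ τ' hatom hmem hstep _ ih =>
    obtain ⟨f, hf0, hf1, hf, hp⟩ := ih
    refine ⟨fun n => Nat.casesOn n τ f, rfl, hf1,
      aux r ch i hi q τ τ₁ f hatom hmem hstep hf0 hf, fun hb => ?_⟩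
    obtain ⟨q₁, i', r', ch', h1, h2, h3⟩ := hp hb
    exact ⟨i :: q₁, i', r', ch', by simpa using h1, by simp [DTree.sub, hi, h2], h3⟩
  | progress r ch i hi q b τ τ₁ τ' hatom hmem hprog _ ih =>
    obtain ⟨f, hf0, hf1, hf, -⟩ := ih
    refine ⟨fun n => Nat.casesOn n τ f, rfl, hf1,
      aux r ch i hi q τ τ₁ f hatom hmem hprog.traceStep hf0 hf, fun _ => ?_⟩
    refine ⟨[], i, r, ch, by simp, rfl, ?_⟩
    simpa [hf0] using hprog

/-- The addresses of a finite tree have bounded length. -/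
theorem DTree.exists_length_bound (T : DTree S) :
    ∃ h : ℕ, ∀ p T', T.sub p = some T' → p.length ≤ h := by
  induction T with
  | bud s =>
    refine ⟨0, fun p T' hp => ?_⟩
    cases p with
    | nil => simp
    | cons i p => simp [DTree.sub] at hp
  | node r ch ih =>
    choose h hh using ih
    refine ⟨Finset.univ.sup h + 1, fun p T' hp => ?_⟩
    cases p with
    | nil => simp
    | cons i p =>
      simp only [DTree.sub] at hp
      split_ifs at hp with hi
      exact Nat.succ_le_succ ((hh _ p T' hp).trans (Finset.le_sup (Finset.mem_univ _)))

/-- Every sequence of self-maps of a nonempty finite type has a coherent sequence of points. -/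
theorem exists_coherent_seq {ι : Type} [Finite ι] [Nonempty ι] (ψ : ℕ → ι → ι) :
    ∃ σ : ℕ → ι, ∀ n, σ n = ψ n (σ (n + 1)) := by
  -- Among the finitely many starting points, one is reached from arbitrarily far ahead.
  classical
  cases nonempty_fintype ι
  -- `g n m x` composes `ψ n, …, ψ (n + m - 1)` and applies the result to `x`.
  let g : ℕ → ℕ → ι → ι := fun n m => Nat.rec (motive := fun _ => ℕ → ι → ι) (fun _ x => x)
    (fun _ ih n x => ψ n (ih (n + 1) x)) m n
  let good : ℕ → ι → Prop := fun n x => ∀ m, ∃ m' ≥ m, ∃ z, g n m' z = x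
  have hstep : ∀ n x, good n x → ∃ y, good (n + 1) y ∧ x = ψ n y := by
    intro n x hx
    by_contra hcon
    push Not at hcon
    have hb : ∀ y, x = ψ n y → ∃ m, ∀ m' ≥ m, ∀ z, g (n + 1) m' z ≠ y := by
      intro y hy
      by_contra hc
      push Not at hc
      exact hcon y hc hy
    choose! m hm using hb
    obtain ⟨m', hm', z, hz⟩ := hx (Finset.univ.sup m + 1)
    obtain ⟨m', rfl⟩ : ∃ k, m' = k + 1 := ⟨m' - 1, by omega⟩
    have hz' : x = ψ n (g (n + 1) m' z) := hz.symm
    have := Finset.le_sup (f := m) (Finset.mem_univ (g (n + 1) m' z))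
    exact hm _ hz' m' (by omega) z rfl
  have h0 : ∃ x, good 0 x := by
    by_contra hcon
    simp only [good] at hcon
    push Not at hcon
    choose m hm using hcon
    obtain ⟨z⟩ := ‹Nonempty ι›
    have := Finset.le_sup (f := m) (Finset.mem_univ (g 0 (Finset.univ.sup m) z))
    exact hm _ _ this z rfl
  choose! nxt hn1 hn2 using hstep
  obtain ⟨x0, hx0⟩ := h0
  let σ : ℕ → ι := fun n => Nat.rec x0 (fun n x => nxt n x) n
  have hσ : ∀ n, good n (σ n) := fun n => by
    induction n with
    | zero => exact hx0
    | succ n ih => exact hn1 n _ ih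
  exact ⟨σ, fun n => hn2 n _ (hσ n)⟩



/-- A cyclic pre-proof all of whose buds have the same companion satisfies the global trace
condition if there are finitely many atoms `goal σ` of the companion such that for every bud, each
`goal σ` at the bud is reached by a progressing trace from some `goal (pred σ)` at the companion.
The choice of the traces along an infinite path has to look ahead; finiteness makes it possible. -/
theorem CyclicPreProof.globalTrace_of_loop {s : Sequent L} (C : CyclicPreProof S s) {c : List ℕ}
    {T₀ : DTree S} (hc : C.tree.sub c = some T₀) (hcomp : ∀ p, C.companion p = c)
    {ι : Type} [Finite ι] [Nonempty ι] (goal : ι → L.Formula ℕ)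
    (hbuds : ∀ p b, C.tree.sub p = some (.bud b) → ∃ q, p = c ++ q ∧
      ∃ pred : ι → ι, ∀ σ, T₀.Trace q true (goal (pred σ)) (goal σ)) :
    C.unfold.GlobalTrace := by
  intro π hπ
  have hbuds' : ∀ p, (∃ b, C.tree.sub p = some (.bud b)) → ∃ (q : List ℕ) (pred : ι → ι)
      (f : ι → ℕ → L.Formula ℕ), p = c ++ q ∧ ∀ σ, f σ 0 = goal (pred σ) ∧
      f σ q.length = goal σ ∧
      (∀ q₁ i, q₁ ++ [i] <+: q → ∃ r ch, T₀.sub q₁ = some (.node r ch) ∧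
        (∃ j t, f σ q₁.length = S.atom j t) ∧ f σ q₁.length ∈ r.concl.left ∧
        r.TraceStep i (f σ q₁.length) (f σ (q₁.length + 1))) ∧
      (∃ q₁ i r ch, q₁ ++ [i] <+: q ∧ T₀.sub q₁ = some (.node r ch) ∧
        r.Progress i (f σ q₁.length) (f σ (q₁.length + 1))) := by
    rintro p ⟨b, hb⟩
    obtain ⟨q, hq, pred, hpred⟩ := hbuds p b hb
    choose f hf0 hf1 hf2 hf3 using fun σ => (hpred σ).exists_fun
    exact ⟨q, pred, f, hq, fun σ => ⟨hf0 σ, hf1 σ, hf2 σ, hf3 σ rfl⟩⟩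
  choose! q pred f hq hf using hbuds'
  choose i hi using fun n => (hπ n).2
  set Q : ℕ → List ℕ := fun n => C.position (π n) with hQ
  have hnode : ∀ n, ∃ r ch, C.tree.sub (Q n) = some (.node r ch) ∧
      C.unfold.label (π n) = some r ∧ i n < r.prems.length := by
    intro n
    obtain ⟨r, hr⟩ := Option.isSome_iff_exists.1 (hπ n).1
    obtain ⟨ch, hch⟩ := C.unfoldLabel_eq_some.1 hr
    refine ⟨r, ch, hch, hr, ?_⟩
    by_contra hlt
    have h1 := C.unfold.no_child _ r hr (i n) (not_lt.1 hlt)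
    have h2 := (hπ (n + 1)).1
    rw [hi, h1] at h2
    simp at h2
  have hQs : ∀ n, Q (n + 1) = C.resolve (Q n ++ [i n]) := fun n => by
    simp only [hQ]
    rw [hi, C.position_append]
  -- `J n`: the step from time `n` to time `n + 1` passes through a bud.
  let J : ℕ → Prop := fun n => ∃ b, C.tree.sub (Q n ++ [i n]) = some (.bud b)
  have hJ : ∀ n, J n → Q (n + 1) = c := by
    rintro n ⟨b, hb⟩
    rw [hQs]
    simp [CyclicPreProof.resolve, hb, hcomp]
  have hnJ : ∀ n, ¬ J n → Q (n + 1) = Q n ++ [i n] := by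
    intro n hn
    rw [hQs]
    unfold CyclicPreProof.resolve
    split
    · rename_i b hb
      exact absurd ⟨b, hb⟩ hn
    · rfl
  have hA : ∀ n, ∃ m, n ≤ m ∧ J m := by
    intro n
    by_contra hcon
    push Not at hcon
    obtain ⟨h, hh⟩ := C.tree.exists_length_bound
    have hlen : ∀ k, (Q (n + k)).length = (Q n).length + k := by
      intro k
      induction k with
      | zero => rfl
      | succ k ih =>
        rw [← add_assoc, hnJ _ (hcon _ (Nat.le_add_right _ _)), List.length_append, ih]
        rfl
    obtain ⟨r, ch, h1, -⟩ := hnode (n + (h + 1))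
    have := hh _ _ h1
    rw [hlen] at this
    omega
  classical
  -- `w n` is the address of the next bud after time `n`, which is reached at time `W n`.
  let W : ℕ → ℕ := fun n => Nat.find (hA n)
  have hW : ∀ n, n ≤ W n ∧ J (W n) := fun n => Nat.find_spec (hA n)
  have hWJ : ∀ n, J n → W n = n := fun n hn =>
    le_antisymm (Nat.find_min' (hA n) ⟨le_rfl, hn⟩) (hW n).1
  have hWn : ∀ n, ¬ J n → W (n + 1) = W n := by
    intro n hn
    refine le_antisymm (Nat.find_min' (hA (n + 1)) ⟨?_, (hW n).2⟩)
      (Nat.find_min' (hA n) ⟨(Nat.le_succ n).trans (hW (n + 1)).1, (hW (n + 1)).2⟩)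
    rcases (hW n).1.eq_or_lt with h | h
    · exact absurd (h ▸ (hW n).2) hn
    · exact h
  let w : ℕ → List ℕ := fun n => Q (W n) ++ [i (W n)]
  have hwJ : ∀ n, J n → w n = Q n ++ [i n] := fun n hn => by simp only [w, hWJ n hn]
  have hwn : ∀ n, ¬ J n → w (n + 1) = w n := fun n hn => by simp only [w, hWn n hn]
  have hB : ∀ k n, W n = n + k → Q n ++ [i n] <+: w n := by
    intro k
    induction k with
    | zero =>
      intro n hn
      have hn : W n = n := hn
      simp only [w, hn, List.prefix_rfl]
    | succ k ih =>
      intro n hn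
      have hJn : ¬ J n := fun h => by
        have := hWJ n h
        omega
      have h1 := ih (n + 1) (by rw [hWn n hJn, hn]; omega)
      rw [hwn n hJn, hnJ n hJn] at h1
      exact (List.prefix_append _ _).trans h1
  have hB : ∀ n, Q n ++ [i n] <+: w n := fun n => hB (W n - n) n (by have := (hW n).1; omega)
  have hwq : ∀ n, w n = c ++ q (w n) := fun n => hq _ (hW n).2
  have hf : ∀ n σ, _ := fun n => hf (w n) (hW n).2
  -- After the first bud the path stays above the companion.
  obtain ⟨m₀, -, hm₀⟩ := hA 0
  set k₀ := m₀ + 1 with hk₀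
  have hu : ∀ n, ∃ u, Q (k₀ + n) = c ++ u := by
    intro n
    induction n with
    | zero => exact ⟨[], by rw [add_zero, hk₀, hJ _ hm₀, List.append_nil]⟩
    | succ n ih =>
      obtain ⟨u, hu⟩ := ih
      by_cases h : J (k₀ + n)
      · exact ⟨[], by rw [← add_assoc, hJ _ h, List.append_nil]⟩
      · exact ⟨u ++ [i (k₀ + n)], by rw [← add_assoc, hnJ _ h, hu, List.append_assoc]⟩
  choose u hu using hu
  obtain ⟨σ, hσ⟩ := exists_coherent_seq
    fun n => if J (k₀ + n) then pred (w (k₀ + n + 1)) else id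
  have hpre : ∀ n, u n ++ [i (k₀ + n)] <+: q (w (k₀ + n)) := by
    intro n
    have h1 := hB (k₀ + n)
    rw [hu, hwq, List.append_assoc] at h1
    exact (List.prefix_append_right_inj c).1 h1
  have huJ : ∀ n, J (k₀ + n) → u (n + 1) = [] := fun n hn => by
    have h1 := hu (n + 1)
    rw [← add_assoc, hJ _ hn] at h1
    simpa using h1
  have hun : ∀ n, ¬ J (k₀ + n) → u (n + 1) = u n ++ [i (k₀ + n)] := fun n hn => by
    have h1 := hu (n + 1)
    rw [← add_assoc, hnJ _ hn, hu, List.append_assoc] at h1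
    exact (List.append_cancel_left h1).symm
  have hqJ : ∀ n, J (k₀ + n) → q (w (k₀ + n)) = u n ++ [i (k₀ + n)] := fun n hn => by
    have h1 := hwq (k₀ + n)
    rw [hwJ _ hn, hu, List.append_assoc] at h1
    rw [hwJ _ hn, hu, List.append_assoc]
    exact (List.append_cancel_left h1).symm
  let τ : ℕ → L.Formula ℕ := fun n => f (w (k₀ + n)) (σ n) (u n).length
  have hτ : ∀ n, τ (n + 1) = f (w (k₀ + n)) (σ n) ((u n).length + 1) := by
    intro n
    simp only [τ]
    have hσn := hσ n
    by_cases h : J (k₀ + n)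
    · rw [if_pos h] at hσn
      rw [huJ n h, hσn, ← add_assoc, List.length_nil, ((hf (k₀ + n + 1)) _).1, ← hσn,
        ← ((hf (k₀ + n)) (σ n)).2.1, hqJ n h, List.length_append]
      rfl
    · rw [if_neg h] at hσn
      rw [hun n h, hσn, ← add_assoc, hwn _ h, List.length_append]
      rfl
  have hsub : ∀ n, C.tree.sub (Q (k₀ + n)) = T₀.sub (u n) := fun n => by
    rw [hu, DTree.sub_append, hc]
    rfl
  refine ⟨k₀, τ, fun n => ?_, fun m => ?_⟩
  · obtain ⟨r, ch, h1, h2, h3⟩ := hnode (k₀ + n)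
    obtain ⟨r', ch', h4, h5, h6, h7⟩ := (hf (k₀ + n) (σ n)).2.2.1 _ _ (hpre n)
    rw [hsub, h4] at h1
    obtain ⟨rfl, -⟩ := DTree.node.inj (Option.some.inj h1)
    refine ⟨h5, r', i (k₀ + n), h2, hi _, h6, ?_⟩
    rw [hτ]
    exact h7
  · obtain ⟨m₁, hm₁, hJ₁⟩ := hA (k₀ + m)
    obtain ⟨n₁, rfl⟩ : ∃ n, m₁ = k₀ + n := ⟨m₁ - k₀, by omega⟩
    set n₂ := n₁ + 1 with hn₂
    obtain ⟨q₁, i', r, ch, hp1, hp2, hp3⟩ := (hf (k₀ + n₂) (σ n₂)).2.2.2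
    -- Up to the progress point, the path follows the branch towards the next bud.
    have hfollow : ∀ l ≤ q₁.length, w (k₀ + (n₂ + l)) = w (k₀ + n₂) ∧ σ (n₂ + l) = σ n₂ ∧
        (u (n₂ + l)).length = l := by
      intro l
      induction l with
      | zero => exact fun _ => ⟨rfl, rfl, by rw [add_zero, huJ n₁ hJ₁, List.length_nil]⟩
      | succ l ih =>
        intro hl
        obtain ⟨ih1, ih2, ih3⟩ := ih (by omega)
        have hnot : ¬ J (k₀ + (n₂ + l)) := fun h => by
          have h1 := congrArg List.length (hqJ _ h)
          have h2 := hp1.length_le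
          rw [ih1] at h1
          simp only [List.length_append, List.length_singleton] at h1 h2
          omega
        have hσn := hσ (n₂ + l)
        rw [if_neg hnot] at hσn
        refine ⟨(hwn _ hnot).trans ih1, hσn.symm.trans ih2, ?_⟩
        rw [← add_assoc, hun _ hnot, List.length_append, ih3]
        rfl
    obtain ⟨h1, h2, h3⟩ := hfollow _ le_rfl
    have hpre' := hpre (n₂ + q₁.length)
    rw [h1] at hpre'
    have heq : u (n₂ + q₁.length) ++ [i (k₀ + (n₂ + q₁.length))] = q₁ ++ [i'] :=
      (List.prefix_of_prefix_length_le hpre' hp1 (by simp [h3])).eq_of_length (by simp [h3])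
    obtain ⟨hu1, hi1⟩ := List.append_inj heq h3
    refine ⟨n₂ + q₁.length, by omega, r, i', ?_, ?_, ?_⟩
    · obtain ⟨r', ch', h4, h5, -⟩ := hnode (k₀ + (n₂ + q₁.length))
      rw [hsub, hu1, hp2] at h4
      obtain ⟨rfl, -⟩ := DTree.node.inj (Option.some.inj h4)
      exact h5
    · simp only [List.cons.injEq, and_true] at hi1
      rw [← hi1]
      exact hi _
    · rw [hτ]
      simp only [τ]
      rw [h1, h2, h3]
      exact hp3

end Cyclic

/-! ### Substitution and free variables -/

section Substitution

variable {L : FirstOrder.Language.{0, 0}}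

theorem mem_fvSet {Γ : Finset (L.Formula ℕ)} {v : ℕ} :
    v ∈ fvSet Γ ↔ ∃ F ∈ Γ, v ∈ BoundedFormula.freeVarFinset F := Iff.rfl

@[simp]
theorem fvSet_empty : fvSet (∅ : Finset (L.Formula ℕ)) = ∅ := by
  ext v
  simp [mem_fvSet]

@[simp]
theorem fvSet_insert (F : L.Formula ℕ) (Γ : Finset (L.Formula ℕ)) :
    fvSet (insert F Γ) = ↑(BoundedFormula.freeVarFinset F) ∪ fvSet Γ := by
  ext v
  simp [mem_fvSet]

@[simp]
theorem fvSet_singleton (F : L.Formula ℕ) :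
    fvSet {F} = ↑(BoundedFormula.freeVarFinset F) := by
  ext v
  simp [mem_fvSet]

@[simp]
theorem substSet_insert (θ : ℕ → L.Term ℕ) (F : L.Formula ℕ) (Γ : Finset (L.Formula ℕ)) :
    substSet θ (insert F Γ) = insert (BoundedFormula.subst F θ) (substSet θ Γ) :=
  Finset.image_insert _ _ _

@[simp]
theorem substSet_singleton (θ : ℕ → L.Term ℕ) (F : L.Formula ℕ) :
    substSet θ {F} = {BoundedFormula.subst F θ} :=
  Finset.image_singleton _ _

theorem varFinsetLeft_relabel_inl {n : ℕ} (t : L.Term ℕ) :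
    (t.relabel (Sum.inl : ℕ → ℕ ⊕ Fin n)).varFinsetLeft = t.varFinset := by
  induction t with
  | var => rfl
  | func f ts ih => simp [ih]

theorem term_subst_congr {α β : Type} [DecidableEq α] {t : L.Term α} {θ θ' : α → L.Term β}
    (h : ∀ v ∈ t.varFinset, θ v = θ' v) : t.subst θ = t.subst θ' := by
  induction t with
  | var v => exact h v (by simp)
  | func f ts ih =>
    simp only [Term.subst, Term.func.injEq, heq_eq_eq, true_and]
    exact funext fun i => ih i fun v hv => h v (by simpa using ⟨i, hv⟩)

theorem term_subst_var {α : Type} (t : L.Term α) : t.subst Term.var = t := by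
  induction t with
  | var v => rfl
  | func f ts ih => simp [ih]

theorem term_relabel_eq_subst {α β : Type} (t : L.Term α) (g : α → β) :
    t.relabel g = t.subst fun v => Term.var (g v) := by
  induction t with
  | var v => rfl
  | func f ts ih => simp [ih]

theorem subst_congr {n : ℕ} {φ : L.BoundedFormula ℕ n} {θ θ' : ℕ → L.Term ℕ}
    (h : ∀ v ∈ φ.freeVarFinset, θ v = θ' v) : φ.subst θ = φ.subst θ' := by
  have aux : ∀ {n : ℕ} (t : L.Term (ℕ ⊕ Fin n)), (∀ v ∈ t.varFinsetLeft, θ v = θ' v) →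
      t.subst (Sum.elim (Term.relabel Sum.inl ∘ θ) (Term.var ∘ Sum.inr)) =
        t.subst (Sum.elim (Term.relabel Sum.inl ∘ θ') (Term.var ∘ Sum.inr)) := by
    intro n t ht
    induction t with
    | var v =>
      rcases v with v | v
      · simp [ht v (by simp)]
      · rfl
    | func f ts ih =>
      simp only [Term.subst, Term.func.injEq, heq_eq_eq, true_and]
      exact funext fun i => ih i fun v hv => ht v (by simpa using ⟨i, hv⟩)
  unfold BoundedFormula.subst
  induction φ with
  | falsum => rfl
  | equal t u =>
    simp only [BoundedFormula.freeVarFinset, Finset.mem_union] at h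
    simp only [BoundedFormula.mapTermRel]
    rw [aux t fun v hv => h v (Or.inl hv), aux u fun v hv => h v (Or.inr hv)]
  | rel R ts =>
    simp only [BoundedFormula.mapTermRel, BoundedFormula.rel.injEq, heq_eq_eq, true_and]
    exact funext fun i => aux (ts i) fun v hv => h v (by simpa using ⟨i, hv⟩)
  | imp _ _ ih1 ih2 =>
    simp only [BoundedFormula.freeVarFinset, Finset.mem_union] at h
    simp only [BoundedFormula.mapTermRel]
    rw [ih1 fun v hv => h v (Or.inl hv), ih2 fun v hv => h v (Or.inr hv)]
  | all _ ih =>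
    simp only [BoundedFormula.mapTermRel]
    rw [ih h]

theorem subst_var {n : ℕ} (φ : L.BoundedFormula ℕ n) : φ.subst Term.var = φ := by
  have aux : ∀ n, (Sum.elim (Term.relabel Sum.inl ∘ Term.var) (Term.var ∘ Sum.inr) :
      ℕ ⊕ Fin n → L.Term (ℕ ⊕ Fin n)) = Term.var := fun n => by
    funext v
    rcases v with v | v <;> rfl
  unfold BoundedFormula.subst
  induction φ with
  | falsum => rfl
  | equal t u => simp only [BoundedFormula.mapTermRel, aux, term_subst_var]
  | rel R ts => simp only [BoundedFormula.mapTermRel, aux, term_subst_var, id]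
  | imp _ _ ih1 ih2 => simp only [BoundedFormula.mapTermRel, ih1, ih2]
  | all _ ih => simp only [BoundedFormula.mapTermRel, ih, id]

theorem subst_eq_self {F : L.Formula ℕ} {θ : ℕ → L.Term ℕ}
    (h : ∀ v ∈ BoundedFormula.freeVarFinset F, θ v = Term.var v) : BoundedFormula.subst F θ = F :=
  (subst_congr h).trans (subst_var F)

theorem exists_of_mem_freeVar_relabel {n k : ℕ} {g : ℕ → ℕ ⊕ Fin n} {φ : L.BoundedFormula ℕ k}
    {v : ℕ} (h : v ∈ (φ.relabel g).freeVarFinset) : ∃ a ∈ φ.freeVarFinset, g a = Sum.inl v := by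
  have aux : ∀ {k : ℕ} (t : L.Term (ℕ ⊕ Fin k)),
      v ∈ (t.relabel (BoundedFormula.relabelAux g k)).varFinsetLeft →
      ∃ a ∈ t.varFinsetLeft, g a = Sum.inl v := by
    intro k t ht
    induction t with
    | var a =>
      rcases a with a | a
      · refine ⟨a, by simp, ?_⟩
        cases hg : g a <;> simp [BoundedFormula.relabelAux, hg] at ht ⊢
        exact ht.symm
      · simp [BoundedFormula.relabelAux] at ht
    | func f ts ih =>
      simp only [Term.relabel, Term.varFinsetLeft, Finset.mem_biUnion, Finset.mem_univ,
        true_and] at ht ⊢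
      obtain ⟨i, hi⟩ := ht
      obtain ⟨a, ha, hg⟩ := ih i hi
      exact ⟨a, ⟨i, ha⟩, hg⟩
  induction φ with
  | falsum => simp at h
  | equal t u =>
    rcases Finset.mem_union.1 h with h | h
    · obtain ⟨a, ha, hg⟩ := aux t h
      exact ⟨a, Finset.mem_union_left _ ha, hg⟩
    · obtain ⟨a, ha, hg⟩ := aux u h
      exact ⟨a, Finset.mem_union_right _ ha, hg⟩
  | rel R ts =>
    obtain ⟨i, -, hi⟩ := Finset.mem_biUnion.1 h
    obtain ⟨a, ha, hg⟩ := aux (ts i) hi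
    exact ⟨a, Finset.mem_biUnion.2 ⟨i, Finset.mem_univ _, ha⟩, hg⟩
  | imp _ _ ih1 ih2 =>
    rcases Finset.mem_union.1 h with h | h
    · obtain ⟨a, ha, hg⟩ := ih1 h
      exact ⟨a, Finset.mem_union_left _ ha, hg⟩
    · obtain ⟨a, ha, hg⟩ := ih2 h
      exact ⟨a, Finset.mem_union_right _ ha, hg⟩
  | all _ ih =>
    rw [BoundedFormula.relabel_all] at h
    exact ih h

theorem mem_freeVar_allF {x v : ℕ} {F : L.Formula ℕ}
    (h : v ∈ BoundedFormula.freeVarFinset (allF x F)) :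
    v ∈ BoundedFormula.freeVarFinset F ∧ v ≠ x := by
  obtain ⟨a, ha, hg⟩ := exists_of_mem_freeVar_relabel (φ := F) h
  split_ifs at hg with hax
  obtain rfl := Sum.inl.inj hg
  exact ⟨ha, hax⟩

/-- Substitution commutes with a relabelling that binds one variable if it does so on variables,
that is, if the substitution leaves the bound variable alone and no substituted term contains it. -/
theorem relabel_subst_comm {k : ℕ} {g : ℕ → ℕ ⊕ Fin 1} {θ : ℕ → L.Term ℕ}
    (h : ∀ v, (Term.var (g v)).subst
      (Sum.elim (fun w => (θ w).relabel Sum.inl) fun i => Term.var (Sum.inr i)) =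
        (θ v).relabel g) (φ : L.BoundedFormula ℕ k) :
    (φ.relabel g).subst θ = (φ.subst θ).relabel g := by
  have aux : ∀ {k : ℕ} (t : L.Term (ℕ ⊕ Fin k)),
      (t.relabel (BoundedFormula.relabelAux g k)).subst
        (Sum.elim (Term.relabel Sum.inl ∘ θ) (Term.var ∘ Sum.inr)) =
      (t.subst (Sum.elim (Term.relabel Sum.inl ∘ θ) (Term.var ∘ Sum.inr))).relabel
        (BoundedFormula.relabelAux g k) := by
    intro k t
    induction t with
    | var a =>
      rcases a with a | a
      · have h1 := congrArg (Term.relabel (Sum.map id (Fin.castAdd k))) (h a)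
        rw [Term.relabel_relabel] at h1
        simp only [Term.relabel, Term.subst, Sum.elim_inl, Function.comp_apply,
          Term.relabel_relabel]
        have h2 : (Sum.map id (Fin.castAdd k) ∘ g : ℕ → ℕ ⊕ Fin (1 + k)) =
            BoundedFormula.relabelAux g k ∘ Sum.inl := by
          funext v
          cases hv : g v <;> simp [BoundedFormula.relabelAux, hv]
        rw [← h2, ← h1]
        cases hv : g a with
        | inl w =>
          simp [BoundedFormula.relabelAux, hv, Function.comp_def]
        | inr w =>
          simp [BoundedFormula.relabelAux, hv]
      · simp [BoundedFormula.relabelAux]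
    | func f ts ih => simp [ih]
  induction φ with
  | falsum => rfl
  | equal t u =>
    exact congrArg₂ BoundedFormula.equal (aux t) (aux u)
  | rel R ts => exact congrArg (BoundedFormula.rel R) (funext fun i => aux (ts i))
  | imp _ _ ih1 ih2 => exact congrArg₂ BoundedFormula.imp ih1 ih2
  | all φ ih =>
    rw [BoundedFormula.relabel_all]
    refine (congrArg BoundedFormula.all ih).trans ?_
    rw [← BoundedFormula.relabel_all]
    rfl

/-- Substitution commutes with a quantifier whose variable does not occur in the substituted
term. -/
theorem subst1_allF {x y : ℕ} {t : L.Term ℕ} (hxy : x ≠ y) (ht : y ∉ t.varFinset)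
    (F : L.Formula ℕ) :
    BoundedFormula.subst (allF y F) (subst1 x t) =
      allF y (BoundedFormula.subst F (subst1 x t)) := by
  refine congrArg BoundedFormula.all (relabel_subst_comm (fun v => ?_) F)
  by_cases hv : v = y
  · subst hv
    simp [subst1, hxy.symm]
  · by_cases hvx : v = x
    · subst hvx
      simp only [hxy, if_false, Term.subst, Sum.elim_inl, subst1, if_true]
      rw [term_relabel_eq_subst, term_relabel_eq_subst]
      refine term_subst_congr fun w hw => ?_
      rw [if_neg (by rintro rfl; exact ht hw)]
    · simp [subst1, hv, hvx]

end Substitution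

/-! ### Building derivations with buds -/

section Derivations

variable {L : FirstOrder.Language.{0, 0}} {S : IndSystem L}

variable (S) in
/-- Provability by the common rules alone, that is, by a finite derivation without buds and without
case splits. -/
inductive CommonProvable : Sequent L → Prop
  | rule (r : CommonRule S) (h : ∀ s ∈ r.prems, CommonProvable s) : CommonProvable r.concl

namespace CommonProvable

theorem ax {Γ Δ : Finset (L.Formula ℕ)} {F : L.Formula ℕ} (h₁ : F ∈ Γ) (h₂ : F ∈ Δ) :
    CommonProvable S ⟨Γ, Δ⟩ :=
  rule (.ax Γ Δ ⟨F, Finset.mem_inter.2 ⟨h₁, h₂⟩⟩) (fun _ h => absurd h List.not_mem_nil)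

theorem wk {Γ Δ Γ' Δ' : Finset (L.Formula ℕ)} (h : CommonProvable S ⟨Γ, Δ⟩) (hΓ : Γ ⊆ Γ')
    (hΔ : Δ ⊆ Δ') : CommonProvable S ⟨Γ', Δ'⟩ :=
  rule (.wk Γ Δ Γ' Δ' hΓ hΔ) fun _ hs => List.mem_singleton.1 hs ▸ h

theorem impL {Γ Δ : Finset (L.Formula ℕ)} {F G : L.Formula ℕ} (h : F.imp G ∈ Γ) (hF : F ∈ Γ)
    (hG : CommonProvable S ⟨insert G Γ, Δ⟩) : CommonProvable S ⟨Γ, Δ⟩ := by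
  have h1 := rule (.impL (S := S) Γ Δ F G) fun s hs => by
    rcases List.mem_cons.1 hs with rfl | hs
    · exact ax hF (Finset.mem_insert_self _ _)
    · exact List.mem_singleton.1 hs ▸ hG
  rwa [CommonRule.concl, Finset.insert_eq_of_mem h] at h1

theorem andL {Γ Δ : Finset (L.Formula ℕ)} {F G : L.Formula ℕ} (h : F ⊓ G ∈ Γ)
    (hFG : CommonProvable S ⟨insert F (insert G Γ), Δ⟩) : CommonProvable S ⟨Γ, Δ⟩ := by
  have h1 := rule (.andL (S := S) Γ Δ F G) fun s hs => List.mem_singleton.1 hs ▸ hFG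
  rwa [CommonRule.concl, Finset.insert_eq_of_mem h] at h1

/-- Modus ponens on the left for an implication with a conjunction as its hypothesis. -/
theorem impAndL {Γ Δ : Finset (L.Formula ℕ)} {F F' G : L.Formula ℕ} (h : (F ⊓ F').imp G ∈ Γ)
    (hF : F ∈ Γ) (hF' : F' ∈ Γ) (hG : CommonProvable S ⟨insert G Γ, Δ⟩) :
    CommonProvable S ⟨Γ, Δ⟩ := by
  have h1 := rule (.impL (S := S) Γ Δ (F ⊓ F') G) fun s hs => by
    rcases List.mem_cons.1 hs with rfl | hs
    · refine rule (.andR (S := S) Γ Δ F F') fun s hs => ?_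
      rcases List.mem_cons.1 hs with rfl | hs
      · exact ax hF (Finset.mem_insert_self _ _)
      · exact List.mem_singleton.1 hs ▸ ax hF' (Finset.mem_insert_self _ _)
    · exact List.mem_singleton.1 hs ▸ hG
  rwa [CommonRule.concl, Finset.insert_eq_of_mem h] at h1

theorem allL {Γ Δ : Finset (L.Formula ℕ)} {x : ℕ} {F : L.Formula ℕ} (t : L.Term ℕ)
    (h : allF x F ∈ Γ)
    (hF : CommonProvable S ⟨insert (BoundedFormula.subst F (subst1 x t)) Γ, Δ⟩) :
    CommonProvable S ⟨Γ, Δ⟩ := by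
  have h1 := rule (.allL (S := S) Γ Δ x F t) fun s hs => List.mem_singleton.1 hs ▸ hF
  rwa [CommonRule.concl, Finset.insert_eq_of_mem h] at h1

/-- An equation `x = t` on the left allows `x` to be replaced by `t` throughout the sequent. -/
theorem eqL {Γ Δ : Finset (L.Formula ℕ)} {x : ℕ} {t : L.Term ℕ}
    (h : (Term.var x).equal t ∈ Γ)
    (hs : CommonProvable S ⟨substSet (subst1 x t) Γ, substSet (subst1 x t) Δ⟩) :
    CommonProvable S ⟨Γ, Δ⟩ := by
  -- The rule exchanges `x` and `t`; a fresh variable `w` takes the place of the occurrences of `t`.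
  obtain ⟨w, hw⟩ := Infinite.exists_notMem_finset
    (insert x ((Γ ∪ Δ).biUnion fun F => BoundedFormula.freeVarFinset F))
  simp only [Finset.mem_insert, Finset.mem_biUnion, Finset.mem_union, not_or, not_exists,
    not_and] at hw
  have e1 : ∀ Ξ : Finset (L.Formula ℕ), (∀ F ∈ Ξ, F ∈ Γ ∨ F ∈ Δ) →
      substSet (subst2 x (Term.var x) w t) Ξ = Ξ := by
    intro Ξ hΞ
    refine (Finset.image_congr fun F hF => subst_eq_self fun v hv => ?_).trans Finset.image_id
    have hvw : v ≠ w := by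
      rintro rfl
      exact hw.2 F (hΞ F hF) hv
    by_cases hvx : v = x <;> simp [subst2, hvw, hvx]
  have e2 : ∀ Ξ : Finset (L.Formula ℕ), (∀ F ∈ Ξ, F ∈ Γ ∨ F ∈ Δ) →
      substSet (subst2 x t w (Term.var x)) Ξ = substSet (subst1 x t) Ξ := by
    intro Ξ hΞ
    refine Finset.image_congr fun F hF => subst_congr fun v hv => ?_
    have hvw : v ≠ w := by
      rintro rfl
      exact hw.2 F (hΞ F hF) hv
    simp [subst1, subst2, hvw]
  have h1 := rule (.eqL (S := S) Γ Δ x w (Ne.symm hw.1) (Term.var x) t) fun s hs' => by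
    rw [List.mem_singleton.1 hs', e2 Γ fun F => Or.inl, e2 Δ fun F => Or.inr]
    exact hs
  rwa [CommonRule.concl, e1 Γ fun F => Or.inl, e1 Δ fun F => Or.inr,
    Finset.insert_eq_of_mem h] at h1

end CommonProvable

/-- `OpenProof s₀ atom goal K s`: there is a derivation of `s` all of whose buds carry the sequent
`s₀`, such that for every bud there is an `f ∈ K` with the following property: for every `σ` there
is a trace from `atom (f σ).2` at the root to `atom (goal σ)` at the bud, with a progress point if
`(f σ).1` is true. Thus `K` records from where at the root the goals at the buds can be traced. -/
def OpenProof {V ι : Type} (s₀ : Sequent L) (atom : V → L.Formula ℕ) (goal : ι → V)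
    (K : Set (ι → Bool × V)) (s : Sequent L) : Prop :=
  ∃ T : DTree S, T.IsDerivation ∧ T.concl = s ∧ ∀ p b, T.sub p = some (.bud b) →
    b = s₀ ∧ ∃ f ∈ K, ∀ σ, T.Trace p (f σ).1 (atom (f σ).2) (atom (goal σ))

namespace OpenProof

variable {V ι : Type} {s₀ : Sequent L} {atom : V → L.Formula ℕ} {goal : ι → V}

theorem bud : OpenProof (S := S) s₀ atom goal {fun σ => (false, goal σ)} s₀ := by
  refine ⟨.bud s₀, trivial, rfl, fun p b h => ?_⟩
  cases p with
  | nil =>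
    obtain rfl := DTree.bud.inj (Option.some.inj h)
    exact ⟨rfl, _, rfl, fun σ => .nil _ _⟩
  | cons i p => simp [DTree.sub] at h

theorem rule {K : Set (ι → Bool × V)} (r : OmegaRule S) (K' : ℕ → Set (ι → Bool × V))
    (h : ∀ i (hi : i < r.prems.length), OpenProof (S := S) s₀ atom goal (K' i) r.prems[i])
    (hK : ∀ i, i < r.prems.length → ∀ f' ∈ K' i, ∃ f ∈ K, ∀ σ,
      (∃ j t, atom (f σ).2 = S.atom j t) ∧ atom (f σ).2 ∈ r.concl.left ∧
      (r.TraceStep i (atom (f σ).2) (atom (f' σ).2) ∧ (f σ).1 = (f' σ).1 ∨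
        r.Progress i (atom (f σ).2) (atom (f' σ).2) ∧ (f σ).1 = true)) :
    OpenProof (S := S) s₀ atom goal K r.concl := by
  choose T hT1 hT2 hT3 using h
  refine ⟨.node r fun i => T i i.2, fun i => ⟨hT2 i i.2, hT1 i i.2⟩, rfl, fun p b hp => ?_⟩
  cases p with
  | nil => simp [DTree.sub] at hp
  | cons i p =>
    simp only [DTree.sub] at hp
    split_ifs at hp with hi
    obtain ⟨rfl, f', hf', htr⟩ := hT3 i hi p b hp
    obtain ⟨f, hf, hσ⟩ := hK i hi f' hf'
    refine ⟨rfl, f, hf, fun σ => ?_⟩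
    obtain ⟨h1, h2, ⟨h3, h4⟩ | ⟨h3, h4⟩⟩ := hσ σ
    · rw [h4]
      exact .step r _ i hi p _ _ _ _ h1 h2 h3 (htr σ)
    · rw [h4]
      exact .progress r _ i hi p _ _ _ _ h1 h2 h3 (htr σ)

theorem mono {K K' : Set (ι → Bool × V)} {s : Sequent L} (hK : K ⊆ K')
    (h : OpenProof (S := S) s₀ atom goal K s) : OpenProof (S := S) s₀ atom goal K' s := by
  obtain ⟨T, h1, h2, h3⟩ := h
  refine ⟨T, h1, h2, fun p b hp => ?_⟩
  obtain ⟨hb, f, hf, ht⟩ := h3 p b hp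
  exact ⟨hb, f, hK hf, ht⟩

theorem of_commonProvable {s : Sequent L} (h : CommonProvable S s) :
    OpenProof (S := S) s₀ atom goal ∅ s := by
  induction h with
  | rule r _ ih =>
    exact rule (.common r) (fun _ => ∅) (fun i hi => ih _ (List.getElem_mem hi))
      fun _ _ _ h => h.elim

theorem wk {K : Set (ι → Bool × V)} {Γ Δ Γ' Δ' : Finset (L.Formula ℕ)}
    (h : OpenProof (S := S) s₀ atom goal K ⟨Γ, Δ⟩) (hΓ : Γ ⊆ Γ') (hΔ : Δ ⊆ Δ')
    (hK : ∀ f ∈ K, ∀ σ, (∃ j t, atom (f σ).2 = S.atom j t) ∧ atom (f σ).2 ∈ Γ') :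
    OpenProof (S := S) s₀ atom goal K ⟨Γ', Δ'⟩ := by
  refine rule (.common (.wk Γ Δ Γ' Δ' hΓ hΔ)) (fun _ => K) (fun i hi => ?_)
    fun i hi f hf => ⟨f, hf, fun σ => ⟨(hK f hf σ).1, (hK f hf σ).2, Or.inl ⟨rfl, rfl⟩⟩⟩
  obtain rfl : i = 0 := by simpa [OmegaRule.prems, CommonRule.prems] using hi
  exact h

theorem cut {K : Set (ι → Bool × V)} {Γ Δ : Finset (L.Formula ℕ)} {F : L.Formula ℕ}
    (h₁ : OpenProof (S := S) s₀ atom goal K ⟨Γ, insert F Δ⟩)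
    (h₂ : CommonProvable S ⟨insert F Γ, Δ⟩)
    (hK : ∀ f ∈ K, ∀ σ, (∃ j t, atom (f σ).2 = S.atom j t) ∧ atom (f σ).2 ∈ Γ) :
    OpenProof (S := S) s₀ atom goal K ⟨Γ, Δ⟩ := by
  refine rule (.common (.cut Γ Δ F)) (fun _ => K) (fun i hi => ?_)
    fun i hi f hf => ⟨f, hf, fun σ => ⟨(hK f hf σ).1, (hK f hf σ).2, Or.inl ⟨rfl, rfl⟩⟩⟩
  have hi' : i < 2 := hi
  interval_cases i
  · exact h₁
  · exact (of_commonProvable h₂).mono (Set.empty_subset _)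

theorem subst {K K' : Set (ι → Bool × V)} {Γ Δ : Finset (L.Formula ℕ)} (θ : ℕ → L.Term ℕ)
    (h : OpenProof (S := S) s₀ atom goal K' ⟨Γ, Δ⟩)
    (hK : ∀ f' ∈ K', ∃ f ∈ K, ∀ σ, (∃ j t, atom (f σ).2 = S.atom j t) ∧
      atom (f σ).2 ∈ substSet θ Γ ∧
      atom (f σ).2 = BoundedFormula.subst (atom (f' σ).2) θ ∧ (f σ).1 = (f' σ).1) :
    OpenProof (S := S) s₀ atom goal K ⟨substSet θ Γ, substSet θ Δ⟩ := by
  refine rule (.common (.subst Γ Δ θ)) (fun _ => K') (fun i hi => ?_) fun i hi f' hf' => ?_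
  · obtain rfl : i = 0 := by simpa [OmegaRule.prems, CommonRule.prems] using hi
    exact h
  · obtain ⟨f, hf, h1⟩ := hK f' hf'
    exact ⟨f, hf, fun σ => ⟨(h1 σ).1, (h1 σ).2.1, Or.inl (h1 σ).2.2⟩⟩

end OpenProof

/-- `Extends T₀ s`: some derivation of `s` contains `T₀` as a subtree in which all its buds lie. -/
def DTree.Extends (T₀ : DTree S) (s : Sequent L) : Prop :=
  ∃ (T : DTree S) (c : List ℕ), T.IsDerivation ∧ T.concl = s ∧ T.sub c = some T₀ ∧
    ∀ p b, T.sub p = some (.bud b) → ∃ q, p = c ++ q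

theorem DTree.Extends.refl {T₀ : DTree S} (h : T₀.IsDerivation) : T₀.Extends T₀.concl :=
  ⟨T₀, [], h, rfl, by simp [DTree.sub], fun p _ _ => ⟨p, rfl⟩⟩

theorem DTree.Extends.rule {T₀ : DTree S} {s : Sequent L} (h : T₀.Extends s) (r : CommonRule S)
    (hr : r.prems = [s]) : T₀.Extends r.concl := by
  obtain ⟨T, c, h1, h2, h3, h4⟩ := h
  have hlen : (OmegaRule.common r).prems.length = 1 := congrArg List.length hr
  refine ⟨.node (.common r) fun _ => T, 0 :: c, fun i => ⟨?_, h1⟩, rfl, ?_, fun p b hp => ?_⟩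
  · rw [h2]
    exact (List.mem_singleton.1 (hr ▸ List.get_mem (OmegaRule.common r).prems i)).symm
  · simp only [DTree.sub, hlen]
    simpa using h3
  · cases p with
    | nil => simp [DTree.sub] at hp
    | cons i p =>
      simp only [DTree.sub] at hp
      split_ifs at hp with hi
      obtain ⟨q, rfl⟩ := h4 p b hp
      obtain rfl : i = 0 := by omega
      exact ⟨q, rfl⟩

/-- A derivation of `s₀` with buds `s₀`, in which every goal at every bud is reached by a
progressing trace from some goal at the root, yields cyclic proofs of the sequents derived from `s₀`
by one-premise rules. -/
theorem OpenProof.cLKIDProvable {V ι : Type} [Finite ι] [Nonempty ι] {s₀ s : Sequent L}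
    {atom : V → L.Formula ℕ} {goal : ι → V} {K : Set (ι → Bool × V)}
    (h : OpenProof (S := S) s₀ atom goal K s₀)
    (hK : ∀ f ∈ K, ∃ pred : ι → ι, ∀ σ, f σ = (true, goal (pred σ)))
    (hs : ∀ T₀ : DTree S, T₀.Extends s₀ → T₀.Extends s) : CLKIDProvable S s := by
  obtain ⟨T₀, h1, h2, h3⟩ := h
  have htr : ∀ q b, T₀.sub q = some (.bud b) → b = s₀ ∧
      ∃ pred : ι → ι, ∀ σ, T₀.Trace q true (atom (goal (pred σ))) (atom (goal σ)) := by
    intro q b hq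
    obtain ⟨hb, f, hf, ht⟩ := h3 q b hq
    obtain ⟨pred, hp⟩ := hK f hf
    refine ⟨hb, pred, fun σ => ?_⟩
    have := ht σ
    rwa [hp] at this
  -- The loop is not a bud itself, as a trace of length zero makes no progress.
  obtain ⟨r, ch, hT₀⟩ : ∃ r ch, T₀ = .node r ch := by
    cases T₀ with
    | node r ch => exact ⟨r, ch, rfl⟩
    | bud b =>
      obtain ⟨-, pred, hp⟩ := htr [] b rfl
      obtain ⟨σ⟩ := ‹Nonempty ι›
      cases hp σ
  obtain ⟨T, c, hT1, hT2, hT3, hT4⟩ := hs T₀ (h2 ▸ .refl h1)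
  have hbud : ∀ p b, T.sub p = some (.bud b) → ∃ q, p = c ++ q ∧ T₀.sub q = some (.bud b) := by
    intro p b hp
    obtain ⟨q, rfl⟩ := hT4 p b hp
    rw [DTree.sub_append, hT3] at hp
    exact ⟨q, rfl, hp⟩
  refine ⟨⟨T, hT1, hT2, fun _ => c, fun p b hp => ?_⟩, ?_⟩
  · obtain ⟨q, -, hq⟩ := hbud p b hp
    refine ⟨r, ch, hT₀ ▸ hT3, ?_⟩
    rw [(htr q b hq).1, ← h2, hT₀]
    rfl
  · refine CyclicPreProof.globalTrace_of_loop _ hT3 (fun _ => rfl) (fun σ => atom (goal σ))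
      fun p b hp => ?_
    obtain ⟨q, hq1, hq2⟩ := hbud p b hp
    exact ⟨q, hq1, (htr q b hq2).2⟩

end Derivations

/-! ### The cyclic proof of the 2-Hydra statement -/

section HydraSubstitution

@[simp]
theorem subst_zeroT (θ : ℕ → hydraLang.Term ℕ) : (zeroT : hydraLang.Term ℕ).subst θ = zeroT :=
  congrArg (Term.func (L := hydraLang) (l := 0) HydraFunc.zero) (Subsingleton.elim _ _)

@[simp]
theorem subst_succT (θ : ℕ → hydraLang.Term ℕ) (t : hydraLang.Term ℕ) :
    (succT t).subst θ = succT (t.subst θ) := by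
  refine congrArg (Term.func (L := hydraLang) (l := 1) HydraFunc.succ) ?_
  funext i
  rw [Subsingleton.elim i 0]
  rfl

theorem term_relabel_inl_subst {L : FirstOrder.Language.{0, 0}} (t : L.Term ℕ)
    (θ : ℕ → L.Term ℕ) :
    (t.relabel (Sum.inl : ℕ → ℕ ⊕ Fin 0)).subst
      (Sum.elim (Term.relabel Sum.inl ∘ θ) (Term.var ∘ Sum.inr)) =
      (t.subst θ).relabel Sum.inl := by
  induction t with
  | var v => rfl
  | func f ts ih => simp [ih]

@[simp]
theorem subst_natF (θ : ℕ → hydraLang.Term ℕ) (t : hydraLang.Term ℕ) :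
    BoundedFormula.subst (natF t) θ = natF (t.subst θ) := by
  refine congrArg (BoundedFormula.rel (L := hydraLang) (l := 1) HydraRel.N) ?_
  funext i
  rw [Subsingleton.elim i 0]
  exact term_relabel_inl_subst t θ

@[simp]
theorem subst_pF (θ : ℕ → hydraLang.Term ℕ) (t u : hydraLang.Term ℕ) :
    BoundedFormula.subst (pF t u) θ = pF (t.subst θ) (u.subst θ) := by
  refine congrArg (BoundedFormula.rel (L := hydraLang) (l := 2) HydraRel.p) ?_
  funext i
  fin_cases i
  · exact term_relabel_inl_subst t θ
  · exact term_relabel_inl_subst u θ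

@[simp]
theorem subst_equal {L : FirstOrder.Language.{0, 0}} (θ : ℕ → L.Term ℕ) (t u : L.Term ℕ) :
    BoundedFormula.subst (t.equal u) θ = (t.subst θ).equal (u.subst θ) :=
  congrArg₂ BoundedFormula.equal (term_relabel_inl_subst t θ) (term_relabel_inl_subst u θ)

@[simp]
theorem subst_imp {L : FirstOrder.Language.{0, 0}} (θ : ℕ → L.Term ℕ) (F G : L.Formula ℕ) :
    BoundedFormula.subst (F.imp G) θ =
      (BoundedFormula.subst F θ).imp (BoundedFormula.subst G θ) := rfl

@[simp]
theorem subst_inf {L : FirstOrder.Language.{0, 0}} (θ : ℕ → L.Term ℕ) (F G : L.Formula ℕ) :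
    BoundedFormula.subst (F ⊓ G) θ = BoundedFormula.subst F θ ⊓ BoundedFormula.subst G θ := rfl

@[simp]
theorem varFinset_zeroT : (zeroT : hydraLang.Term ℕ).varFinset = ∅ := rfl

@[simp]
theorem varFinset_succT (t : hydraLang.Term ℕ) : (succT t).varFinset = t.varFinset := by
  ext v
  simp [succT]

@[simp]
theorem freeVar_natF (t : hydraLang.Term ℕ) :
    BoundedFormula.freeVarFinset (natF t) = t.varFinset := by
  ext v
  simp [natF, Relations.formula, Relations.boundedFormula, varFinsetLeft_relabel_inl]

@[simp]
theorem freeVar_pF (t u : hydraLang.Term ℕ) :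
    BoundedFormula.freeVarFinset (pF t u) = t.varFinset ∪ u.varFinset := by
  ext v
  simp [pF, Relations.formula, Relations.boundedFormula, varFinsetLeft_relabel_inl,
    Fin.exists_fin_two]

@[simp]
theorem freeVar_equal {L : FirstOrder.Language.{0, 0}} (t u : L.Term ℕ) :
    BoundedFormula.freeVarFinset (t.equal u) = t.varFinset ∪ u.varFinset := by
  simp [Term.equal, Term.bdEqual, varFinsetLeft_relabel_inl]

theorem freeVar_inf {L : FirstOrder.Language.{0, 0}} (F G : L.Formula ℕ) :
    BoundedFormula.freeVarFinset (F ⊓ G) =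
      BoundedFormula.freeVarFinset F ∪ BoundedFormula.freeVarFinset G := by
  change (BoundedFormula.freeVarFinset F ∪ (BoundedFormula.freeVarFinset G ∪ ∅)) ∪ ∅ = _
  simp

theorem mem_freeVar_allN {x v : ℕ} {F : hydraLang.Formula ℕ}
    (h : v ∈ BoundedFormula.freeVarFinset (allN x F)) :
    v ∈ BoundedFormula.freeVarFinset F ∧ v ≠ x := by
  obtain ⟨h1, h2⟩ := mem_freeVar_allF h
  simpa [h2] using h1

theorem mem_freeVar_allN2 {x y v : ℕ} {F : hydraLang.Formula ℕ}
    (h : v ∈ BoundedFormula.freeVarFinset (allN2 x y F)) :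
    v ∈ BoundedFormula.freeVarFinset F ∧ v ≠ x ∧ v ≠ y := by
  obtain ⟨h1, h2⟩ := mem_freeVar_allF h
  obtain ⟨h3, h4⟩ := mem_freeVar_allF h1
  refine ⟨?_, h2, h4⟩
  simpa [freeVar_inf, h2, h4] using h3

@[simp]
theorem freeVar_Ha : BoundedFormula.freeVarFinset Ha = ∅ := by
  refine Finset.eq_empty_of_forall_notMem fun v hv => ?_
  obtain ⟨h1, h2⟩ := mem_freeVar_allN hv
  simp [freeVar_inf, h2] at h1

@[simp]
theorem freeVar_Hb : BoundedFormula.freeVarFinset Hb = ∅ := by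
  refine Finset.eq_empty_of_forall_notMem fun v hv => ?_
  obtain ⟨h1, h2, h3⟩ := mem_freeVar_allN2 hv
  simp [h2, h3] at h1

@[simp]
theorem freeVar_Hc : BoundedFormula.freeVarFinset Hc = ∅ := by
  refine Finset.eq_empty_of_forall_notMem fun v hv => ?_
  obtain ⟨h1, h2⟩ := mem_freeVar_allN hv
  simp [h2] at h1

@[simp]
theorem freeVar_Hd : BoundedFormula.freeVarFinset Hd = ∅ := by
  refine Finset.eq_empty_of_forall_notMem fun v hv => ?_
  obtain ⟨h1, h2⟩ := mem_freeVar_allN hv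
  simp [h2] at h1

@[simp]
theorem subst_Ha (θ : ℕ → hydraLang.Term ℕ) : BoundedFormula.subst Ha θ = Ha :=
  subst_eq_self (by simp)

@[simp]
theorem subst_Hb (θ : ℕ → hydraLang.Term ℕ) : BoundedFormula.subst Hb θ = Hb :=
  subst_eq_self (by simp)

@[simp]
theorem subst_Hc (θ : ℕ → hydraLang.Term ℕ) : BoundedFormula.subst Hc θ = Hc :=
  subst_eq_self (by simp)

@[simp]
theorem subst_Hd (θ : ℕ → hydraLang.Term ℕ) : BoundedFormula.subst Hd θ = Hd :=
  subst_eq_self (by simp)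

end HydraSubstitution

section HydraInstances

variable {Γ Δ : Finset (hydraLang.Formula ℕ)} {t u : hydraLang.Term ℕ}

theorem CommonProvable.allN_elim {x : ℕ} {F : hydraLang.Formula ℕ} (h : allN x F ∈ Γ)
    (ht : natF t ∈ Γ)
    (hF : CommonProvable hydraSystem ⟨insert (BoundedFormula.subst F (subst1 x t)) Γ, Δ⟩) :
    CommonProvable hydraSystem ⟨Γ, Δ⟩ := by
  refine .allL t h (.impL (F := natF t) (G := BoundedFormula.subst F (subst1 x t)) ?_
    (Finset.mem_insert_of_mem ht) (hF.wk ?_ subset_rfl))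
  · simp [subst1]
  · exact Finset.insert_subset_insert _ (Finset.subset_insert _ _)

theorem commonProvable_of_Ha (h : Ha ∈ Γ) (ht : natF t ∈ Γ)
    (hΔ : pF zeroT zeroT ∈ Δ ∨ pF (succT zeroT) zeroT ∈ Δ ∨ pF t (succT zeroT) ∈ Δ) :
    CommonProvable hydraSystem ⟨Γ, Δ⟩ := by
  refine .allN_elim h ht (.andL (F := pF zeroT zeroT)
    (G := pF (succT zeroT) zeroT ⊓ pF t (succT zeroT)) (by simp [subst1])
    (.andL (F := pF (succT zeroT) zeroT) (G := pF t (succT zeroT)) (by simp) ?_))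
  rcases hΔ with h | h | h <;> exact .ax (by simp) h

theorem commonProvable_of_Hb (h : Hb ∈ Γ) (ht1 : 1 ∉ t.varFinset) (ht : natF t ∈ Γ)
    (hu : natF u ∈ Γ) (hp : pF t u ∈ Γ) (hΔ : pF (succT t) (succT (succT u)) ∈ Δ) :
    CommonProvable hydraSystem ⟨Γ, Δ⟩ := by
  refine .allL t h ?_
  rw [subst1_allF zero_ne_one ht1]
  refine .allL u (Finset.mem_insert_self _ _) (.impAndL (F := natF t) (F' := natF u)
    (G := (pF t u).imp (pF (succT t) (succT (succT u)))) ?_ (by simp [ht]) (by simp [hu])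
    (.impL (F := pF t u) (G := pF (succT t) (succT (succT u))) (by simp) (by simp [hp])
      (.ax (by simp) hΔ)))
  have hts : t.subst (subst1 1 u) = t :=
    (term_subst_congr fun v hv => by
      rw [subst1, if_neg (by rintro rfl; exact ht1 hv)]).trans (term_subst_var t)
  simp [subst1] at hts ⊢
  simp [hts]

theorem commonProvable_of_Hc (h : Hc ∈ Γ) (ht : natF t ∈ Γ) (hp : pF (succT t) t ∈ Γ)
    (hΔ : pF zeroT (succT (succT t)) ∈ Δ) : CommonProvable hydraSystem ⟨Γ, Δ⟩ :=
  .allN_elim h ht (.impL (F := pF (succT t) t) (G := pF zeroT (succT (succT t)))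
    (by simp [subst1]) (by simp [hp]) (.ax (by simp) hΔ))

theorem commonProvable_of_Hd (h : Hd ∈ Γ) (ht : natF t ∈ Γ) (hp : pF (succT t) t ∈ Γ)
    (hΔ : pF (succT (succT t)) zeroT ∈ Δ) : CommonProvable hydraSystem ⟨Γ, Δ⟩ :=
  .allN_elim h ht (.impL (F := pF (succT t) t) (G := pF (succT (succT t)) zeroT)
    (by simp [subst1]) (by simp [hp]) (.ax (by simp) hΔ))

end HydraInstances

section HydraLoop

/-- The hypotheses `H_a, H_b, H_c, H_d` of the 2-Hydra statement. -/
noncomputable def hydraHyps : Finset (hydraLang.Formula ℕ) := {Ha, Hb, Hc, Hd}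

/-- The sequent `H_a, H_b, H_c, H_d, N x, N y ⊢ p(x, y)`, to which all buds return. -/
noncomputable def hydraLoop : Sequent hydraLang :=
  ⟨insert (natF (Term.var 0)) (insert (natF (Term.var 1)) hydraHyps),
    {pF (Term.var 0) (Term.var 1)}⟩

/-- Open derivations with buds `hydraLoop`. The traced atoms are `N v` for variables `v`, and the
goals at a bud are `N x` and `N y`. -/
abbrev HydraOpen (K : Set (Bool → Bool × ℕ)) (s : Sequent hydraLang) : Prop :=
  OpenProof (S := hydraSystem) hydraLoop (fun v => natF (Term.var v)) (fun σ => cond σ 1 0) K s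

@[simp]
theorem relabel_zeroT {V W : Type} (g : V → W) :
    (zeroT : hydraLang.Term V).relabel g = zeroT :=
  congrArg (Term.func (L := hydraLang) (l := 0) HydraFunc.zero) (Subsingleton.elim _ _)

@[simp]
theorem relabel_succT {V W : Type} (g : V → W) (t : hydraLang.Term V) :
    (succT t).relabel g = succT (t.relabel g) := by
  refine congrArg (Term.func (L := hydraLang) (l := 1) HydraFunc.succ) ?_
  funext i
  rw [Subsingleton.elim i 0]
  rfl

theorem atom_eq_natF (i : Fin hydraSystem.n) (t : hydraLang.Term ℕ) :
    (hydraSystem.atom i fun _ => t) = natF t := by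
  refine congrArg (Relations.formula (L := hydraLang) (n := 1) HydraRel.N) ?_
  funext i
  rw [Subsingleton.elim i 0]
  rfl

theorem natF_eq_atom (t : hydraLang.Term ℕ) : natF t = hydraSystem.atom 0 ![t] := rfl

/-- A bud for `p(v, w)`, after a substitution, used as a lemma. -/
theorem HydraOpen.cut_bud {Γ Δ : Finset (hydraLang.Formula ℕ)} {v w : ℕ} (hH : hydraHyps ⊆ Γ)
    (hv : natF (Term.var v) ∈ Γ) (hw : natF (Term.var w) ∈ Γ)
    (h : CommonProvable hydraSystem ⟨insert (pF (Term.var v) (Term.var w)) Γ, Δ⟩) :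
    HydraOpen {fun σ => (false, cond σ w v)} ⟨Γ, Δ⟩ := by
  let θ : ℕ → hydraLang.Term ℕ := subst2 0 (Term.var v) 1 (Term.var w)
  have hΓ : substSet θ (insert (natF (Term.var 0)) (insert (natF (Term.var 1)) hydraHyps)) =
      insert (natF (Term.var v)) (insert (natF (Term.var w)) hydraHyps) := by
    simp [θ, hydraHyps, subst2]
  have hK : ∀ f ∈ ({fun σ => (false, cond σ w v)} : Set (Bool → Bool × ℕ)), ∀ σ,
      (∃ j t, natF (Term.var (f σ).2) = hydraSystem.atom j t) ∧ natF (Term.var (f σ).2) ∈ Γ := by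
    rintro f rfl σ
    refine ⟨⟨0, _, natF_eq_atom _⟩, ?_⟩
    cases σ
    · exact hv
    · exact hw
  have h1 : HydraOpen {fun σ => (false, cond σ w v)}
      ⟨substSet θ (insert (natF (Term.var 0)) (insert (natF (Term.var 1)) hydraHyps)),
        substSet θ {pF (Term.var 0) (Term.var 1)}⟩ := by
    refine OpenProof.subst θ OpenProof.bud ?_
    rintro f' rfl
    refine ⟨_, rfl, fun σ => ⟨⟨0, _, natF_eq_atom _⟩, ?_, ?_, rfl⟩⟩
    · rw [hΓ]
      cases σ <;> simp
    · cases σ <;> simp [θ, subst2]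
  refine OpenProof.cut (OpenProof.wk h1 ?_ ?_ hK) h hK
  · rw [hΓ]
    exact Finset.insert_subset hv (Finset.insert_subset hw hH)
  · simp [θ, subst2]

/-- The case split on `N v`. The trace that has arrived at the fresh variable `k` comes from `v` and
progresses. -/
theorem HydraOpen.case {Γ Δ : Finset (hydraLang.Formula ℕ)} {v : ℕ} (k : ℕ)
    {K K₀ K₁ : Set (Bool → Bool × ℕ)} (hv : natF (Term.var v) ∈ Γ) (hk : k ∉ fvSet Γ ∪ fvSet Δ)
    (h₀ : HydraOpen K₀ ⟨insert ((Term.var v).equal zeroT) Γ, Δ⟩)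
    (h₁ : HydraOpen K₁ ⟨insert (natF (Term.var k))
      (insert ((Term.var v).equal (succT (Term.var k))) Γ), Δ⟩)
    (hK₀ : ∀ f ∈ K₀, f ∈ K ∧ ∀ σ, natF (Term.var (f σ).2) ∈ Γ)
    (hK₁ : ∀ f ∈ K₁, (fun σ => if (f σ).2 = k then (true, v) else f σ) ∈ K ∧
      ∀ σ, (f σ).2 ≠ k → natF (Term.var (f σ).2) ∈ Γ) :
    HydraOpen K ⟨Γ, Δ⟩ := by
  have hΓ : insert (hydraSystem.atom 0 ![Term.var v]) Γ = Γ := Finset.insert_eq_of_mem hv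
  let r : OmegaRule hydraSystem := .case Γ Δ 0 ![Term.var v] (fun pr l => k + l)
    (fun pr _ l l' h => Fin.ext (Nat.add_left_cancel h)) (by
      intro pr hpr l
      rw [hΓ]
      simp only [List.mem_cons, List.not_mem_nil, or_false] at hpr
      rcases hpr with rfl | rfl
      · exact l.elim0
      · obtain rfl : l = (0 : Fin 1) := Subsingleton.elim (α := Fin 1) _ _
        exact hk)
  have hr : r.concl = ⟨Γ, Δ⟩ := by
    simp only [r, OmegaRule.concl, hΓ]
  have hs0 : caseDistinction (S := hydraSystem) (j := 0) Γ Δ ![Term.var v] (zeroProd 0)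
      (fun l => k + l) =
      ⟨insert ((Term.var v).equal zeroT) Γ, Δ⟩ := by
    simp only [caseDistinction, zeroProd]
    congr 1
    ext F
    simp
  have hs1 : caseDistinction (S := hydraSystem) (j := 0) Γ Δ ![Term.var v] (succProd 0)
      (fun l => k + l) =
      ⟨insert (natF (Term.var k)) (insert ((Term.var v).equal (succT (Term.var k))) Γ), Δ⟩ := by
    simp only [caseDistinction, succProd]
    congr 1
    ext F
    simp [atom_eq_natF]
    tauto
  rw [← hr]
  refine OpenProof.rule r (fun i => if i = 0 then K₀ else K₁) (fun i hi => ?_) fun i hi f' hf' => ?_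
  · have hi' : i < 2 := hi
    interval_cases i
    · exact (congrArg (HydraOpen K₀) hs0).mpr h₀
    · exact (congrArg (HydraOpen K₁) hs1).mpr h₁
  · have hi' : i < 2 := hi
    interval_cases i
    · obtain ⟨h1, h2⟩ := hK₀ f' hf'
      refine ⟨f', h1, fun σ => ⟨⟨0, _, natF_eq_atom _⟩, hr ▸ h2 σ, Or.inl ⟨Or.inl rfl, rfl⟩⟩⟩
    · obtain ⟨h1, h2⟩ := hK₁ f' hf'
      refine ⟨_, h1, fun σ => ⟨⟨0, _, natF_eq_atom _⟩, ?_⟩⟩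
      by_cases hσ : (f' σ).2 = k
      · simp only [hσ, if_true]
        refine ⟨hr ▸ hv, Or.inr ⟨⟨rfl, succProd 0, rfl,
          ⟨0, fun _ => Term.var (0 : Fin 1)⟩, List.mem_singleton_self _, ?_⟩, trivial⟩⟩
        exact (atom_eq_natF 0 (Term.var k)).symm
      · simp only [hσ, if_false]
        exact ⟨hr ▸ h2 σ hσ, Or.inl ⟨Or.inl rfl, trivial⟩⟩

section Leaves

/-! The leaves of the loop without a bud below them, with `x, y = v₀, v₁`. The equations come from
the case splits, and `p(v, w)` from the bud. -/

variable {Γ : Finset (hydraLang.Formula ℕ)}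

theorem hydra_leaf_zero_zero (H : Ha ∈ Γ) (h : natF (Term.var 0) ∈ Γ)
    (h0 : (Term.var 0).equal zeroT ∈ Γ)
    (h1 : (Term.var 1).equal zeroT ∈ Γ) :
    CommonProvable hydraSystem ⟨Γ, {pF (Term.var 0) (Term.var 1)}⟩ := by
  refine .wk (Γ := {Ha, natF (Term.var 0), (Term.var 0).equal zeroT, (Term.var 1).equal zeroT})
    (.eqL (x := 0) (t := zeroT) (by simp) (.eqL (x := 1) (t := zeroT) (by simp [subst1])
      (commonProvable_of_Ha (t := zeroT) ?_ ?_ ?_)))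
    (by simp [Finset.insert_subset_iff, *]) subset_rfl <;>
    simp [subst1]

theorem hydra_leaf_one_zero (H : Ha ∈ Γ) (h : natF (Term.var 3) ∈ Γ)
    (h0 : (Term.var 0).equal (succT (Term.var 3)) ∈ Γ)
    (h3 : (Term.var 3).equal zeroT ∈ Γ) (h1 : (Term.var 1).equal zeroT ∈ Γ) :
    CommonProvable hydraSystem ⟨Γ, {pF (Term.var 0) (Term.var 1)}⟩ := by
  refine .wk (Γ := {Ha, natF (Term.var 3), (Term.var 0).equal (succT (Term.var 3)),
      (Term.var 3).equal zeroT, (Term.var 1).equal zeroT})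
    (.eqL (x := 0) (t := succT (Term.var 3)) (by simp)
      (.eqL (x := 1) (t := zeroT) (by simp [subst1]) (.eqL (x := 3) (t := zeroT) (by simp [subst1])
        (commonProvable_of_Ha (t := zeroT) ?_ ?_ ?_))))
    (by simp [Finset.insert_subset_iff, *]) subset_rfl <;>
    simp [subst1]

theorem hydra_leaf_succ_succ_zero (H : Hd ∈ Γ) (h : natF (Term.var 4) ∈ Γ)
    (h0 : (Term.var 0).equal (succT (Term.var 3)) ∈ Γ)
    (h3 : (Term.var 3).equal (succT (Term.var 4)) ∈ Γ) (h1 : (Term.var 1).equal zeroT ∈ Γ)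
    (hp : pF (Term.var 3) (Term.var 4) ∈ Γ) :
    CommonProvable hydraSystem ⟨Γ, {pF (Term.var 0) (Term.var 1)}⟩ := by
  refine .wk (Γ := {Hd, natF (Term.var 4), (Term.var 0).equal (succT (Term.var 3)),
      (Term.var 3).equal (succT (Term.var 4)), (Term.var 1).equal zeroT,
      pF (Term.var 3) (Term.var 4)})
    (.eqL (x := 0) (t := succT (Term.var 3)) (by simp)
      (.eqL (x := 1) (t := zeroT) (by simp [subst1])
        (.eqL (x := 3) (t := succT (Term.var 4)) (by simp [subst1])
          (commonProvable_of_Hd (t := Term.var 4) ?_ ?_ ?_ ?_))))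
    (by simp [Finset.insert_subset_iff, *]) subset_rfl <;>
    simp [subst1]

theorem hydra_leaf_one (H : Ha ∈ Γ) (h : natF (Term.var 0) ∈ Γ)
    (h1 : (Term.var 1).equal (succT (Term.var 2)) ∈ Γ) (h2 : (Term.var 2).equal zeroT ∈ Γ) :
    CommonProvable hydraSystem ⟨Γ, {pF (Term.var 0) (Term.var 1)}⟩ := by
  refine .wk (Γ := {Ha, natF (Term.var 0), (Term.var 1).equal (succT (Term.var 2)),
      (Term.var 2).equal zeroT})
    (.eqL (x := 1) (t := succT (Term.var 2)) (by simp)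
      (.eqL (x := 2) (t := zeroT) (by simp [subst1])
        (commonProvable_of_Ha (t := Term.var 0) ?_ ?_ ?_)))
    (by simp [Finset.insert_subset_iff, *]) subset_rfl <;>
    simp [subst1]

theorem hydra_leaf_zero_succ_succ (H : Hc ∈ Γ) (h : natF (Term.var 3) ∈ Γ)
    (h0 : (Term.var 0).equal zeroT ∈ Γ) (h1 : (Term.var 1).equal (succT (Term.var 2)) ∈ Γ)
    (h2 : (Term.var 2).equal (succT (Term.var 3)) ∈ Γ) (hp : pF (Term.var 2) (Term.var 3) ∈ Γ) :
    CommonProvable hydraSystem ⟨Γ, {pF (Term.var 0) (Term.var 1)}⟩ := by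
  refine .wk (Γ := {Hc, natF (Term.var 3), (Term.var 0).equal zeroT,
      (Term.var 1).equal (succT (Term.var 2)), (Term.var 2).equal (succT (Term.var 3)),
      pF (Term.var 2) (Term.var 3)})
    (.eqL (x := 0) (t := zeroT) (by simp)
      (.eqL (x := 1) (t := succT (Term.var 2)) (by simp [subst1])
        (.eqL (x := 2) (t := succT (Term.var 3)) (by simp [subst1])
          (commonProvable_of_Hc (t := Term.var 3) ?_ ?_ ?_ ?_))))
    (by simp [Finset.insert_subset_iff, *]) subset_rfl <;>
    simp [subst1]

theorem hydra_leaf_succ_succ_succ (H : Hb ∈ Γ) (h4 : natF (Term.var 4) ∈ Γ)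
    (h3 : natF (Term.var 3) ∈ Γ) (h0 : (Term.var 0).equal (succT (Term.var 4)) ∈ Γ)
    (h1 : (Term.var 1).equal (succT (Term.var 2)) ∈ Γ)
    (h2 : (Term.var 2).equal (succT (Term.var 3)) ∈ Γ) (hp : pF (Term.var 4) (Term.var 3) ∈ Γ) :
    CommonProvable hydraSystem ⟨Γ, {pF (Term.var 0) (Term.var 1)}⟩ := by
  refine .wk (Γ := {Hb, natF (Term.var 4), natF (Term.var 3),
      (Term.var 0).equal (succT (Term.var 4)),
      (Term.var 1).equal (succT (Term.var 2)), (Term.var 2).equal (succT (Term.var 3)),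
      pF (Term.var 4) (Term.var 3)})
    (.eqL (x := 0) (t := succT (Term.var 4)) (by simp)
      (.eqL (x := 1) (t := succT (Term.var 2)) (by simp [subst1])
        (.eqL (x := 2) (t := succT (Term.var 3)) (by simp [subst1])
          (commonProvable_of_Hb (t := Term.var 4) (u := Term.var 3) ?_ ?_ ?_ ?_ ?_ ?_))))
    (by simp [Finset.insert_subset_iff, *]) subset_rfl <;>
    simp [subst1]

end Leaves

theorem hydraHyps_subset {Γ : Finset (hydraLang.Formula ℕ)} :
    hydraHyps ⊆ Γ ↔ Ha ∈ Γ ∧ Hb ∈ Γ ∧ Hc ∈ Γ ∧ Hd ∈ Γ := by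
  simp [hydraHyps, Finset.insert_subset_iff]

@[simp]
theorem fvSet_hydraHyps : fvSet hydraHyps = ∅ := by
  simp [hydraHyps]

/-- The body of the loop. The functions in `K₀` and `K₁` tell from which variable the two goals at a
bud are traced, and whether the trace has progressed yet. -/
theorem hydraOpen_loop :
    HydraOpen {f | ∃ pred : Bool → Bool, ∀ σ, f σ = (true, cond (pred σ) 1 0)} hydraLoop := by
  have hA : Ha ∈ hydraHyps := by simp [hydraHyps]
  have hB : Hb ∈ hydraHyps := by simp [hydraHyps]
  have hC : Hc ∈ hydraHyps := by simp [hydraHyps]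
  have hD : Hd ∈ hydraHyps := by simp [hydraHyps]
  -- Case distinction on `y`: either `y = 0` or `y = s y'` with `y' = v₂`.
  refine HydraOpen.case (v := 1) 2 (K₀ := {fun _ => (true, 0)})
    (K₁ := {fun σ => (true, cond σ 2 0), fun σ => (σ, 2)}) (by simp) (by simp) ?_ ?_ ?_ ?_
  · -- `y = 0`: distinguish `x = 0`, `x = 1`, and `x = s s x''` with `x' = v₃`, `x'' = v₄`.
    refine HydraOpen.case (v := 0) 3 (K₀ := ∅) (K₁ := {fun σ => (σ, 3)}) (by simp) (by simp)
      (.of_commonProvable (hydra_leaf_zero_zero ?_ ?_ ?_ ?_)) ?_ ?_ ?_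
    case refine_5 =>
      refine HydraOpen.case (v := 3) 4 (K₀ := ∅) (K₁ := {fun σ => (false, cond σ 4 3)}) (by simp)
        (by simp) (.of_commonProvable (hydra_leaf_one_zero ?_ ?_ ?_ ?_ ?_))
        (HydraOpen.cut_bud (v := 3) (w := 4) ?_ ?_ ?_ (hydra_leaf_succ_succ_zero ?_ ?_ ?_ ?_ ?_ ?_))
        ?_ ?_
      case refine_15 => simp
      case refine_16 =>
        rintro f rfl
        refine ⟨funext fun σ => ?_, fun σ => ?_⟩ <;> cases σ <;> simp
      all_goals simp [hydraHyps_subset, hA, hB, hC, hD]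
    case refine_6 => simp
    case refine_7 =>
      rintro f rfl
      refine ⟨funext fun σ => ?_, fun σ => ?_⟩ <;> cases σ <;> simp
    all_goals simp [hA]
  · -- `y = s y'`: distinguish `y' = 0` and `y' = s y''` with `y'' = v₃`; in the latter case,
    -- distinguish `x = 0` and `x = s x'` with `x' = v₄`.
    refine HydraOpen.case (v := 2) 3 (K₀ := ∅)
      (K₁ := {fun σ => (!σ, cond σ 3 0), fun σ => (false, cond σ 3 2)}) (by simp) (by simp)
      (.of_commonProvable (hydra_leaf_one ?_ ?_ ?_ ?_)) ?_ ?_ ?_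
    case refine_5 =>
      refine HydraOpen.case (v := 0) 4 (K₀ := {fun σ => (false, cond σ 3 2)})
        (K₁ := {fun σ => (false, cond σ 3 4)}) (by simp) (by simp)
        (HydraOpen.cut_bud (v := 2) (w := 3) ?_ ?_ ?_ (hydra_leaf_zero_succ_succ ?_ ?_ ?_ ?_ ?_ ?_))
        (HydraOpen.cut_bud (v := 4) (w := 3) ?_ ?_ ?_
          (hydra_leaf_succ_succ_succ ?_ ?_ ?_ ?_ ?_ ?_ ?_)) ?_ ?_
      case refine_20 =>
        rintro f rfl
        refine ⟨by simp, fun σ => ?_⟩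
        cases σ <;> simp
      case refine_21 =>
        rintro f rfl
        refine ⟨Or.inl (funext fun σ => ?_), fun σ => ?_⟩ <;> cases σ <;> simp
      all_goals simp [hydraHyps_subset, hA, hB, hC, hD]
    case refine_6 => simp
    case refine_7 =>
      rintro f (rfl | rfl)
      · refine ⟨Or.inl (funext fun σ => ?_), fun σ => ?_⟩ <;> cases σ <;> simp
      · refine ⟨Or.inr (funext fun σ => ?_), fun σ => ?_⟩ <;> cases σ <;> simp
    all_goals simp [hA]
  · rintro f rfl
    exact ⟨⟨fun _ => false, fun _ => rfl⟩, by simp⟩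
  · rintro f (rfl | rfl)
    · refine ⟨⟨id, fun σ => ?_⟩, fun σ => ?_⟩ <;> cases σ <;> simp
    · exact ⟨⟨fun _ => true, fun σ => by simp⟩, by simp⟩

theorem extends_hydraH (T₀ : DTree hydraSystem) (h : T₀.Extends hydraLoop) :
    T₀.Extends ⟨∅, {hydraH}⟩ := by
  have hfv : ∀ v : ℕ, v ∉ fvSet hydraHyps ∪ fvSet (∅ : Finset (hydraLang.Formula ℕ)) := by simp
  have h1 := h.rule (.andL hydraHyps _ _ _) rfl
  have h2 := h1.rule (.impR hydraHyps ∅ (natF (Term.var 0) ⊓ natF (Term.var 1))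
    (pF (Term.var 0) (Term.var 1)))
    (by simp only [CommonRule.prems, CommonRule.concl, insert_empty_eq])
  have h3 := h2.rule (.allR hydraHyps ∅ 1 _ (hfv 1)) rfl
  have h4 := h3.rule (.allR hydraHyps ∅ 0 _ (hfv 0)) rfl
  have h5 := h4.rule (.andL {Ha, Hb} {allN2 0 1 (pF (Term.var 0) (Term.var 1))} Hc Hd) (by
    simp only [CommonRule.prems, CommonRule.concl, insert_empty_eq, hydraHyps, allN2]
    congr 2
    ext F
    simp only [Finset.mem_insert, Finset.mem_singleton]
    tauto)
  have h6 := h5.rule (.andL {Ha} {allN2 0 1 (pF (Term.var 0) (Term.var 1))} Hb (Hc ⊓ Hd)) (by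
    simp only [CommonRule.prems, CommonRule.concl]
    congr 2
    ext F
    simp only [Finset.mem_insert, Finset.mem_singleton]
    tauto)
  have h7 := h6.rule (.andL ∅ {allN2 0 1 (pF (Term.var 0) (Term.var 1))} Ha (Hb ⊓ (Hc ⊓ Hd))) (by
    simp only [CommonRule.prems, CommonRule.concl]
    congr 2
    ext F
    simp only [Finset.mem_insert, Finset.mem_singleton, Finset.notMem_empty]
    tauto)
  have h8 := h7.rule (.impR ∅ ∅ (Ha ⊓ (Hb ⊓ (Hc ⊓ Hd)))
    (allN2 0 1 (pF (Term.var 0) (Term.var 1))))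
    (by simp only [CommonRule.prems, CommonRule.concl, insert_empty_eq])
  simpa only [CommonRule.concl, insert_empty_eq, hydraH] using h8

theorem cLKIDProvable_hydraH : CLKIDProvable hydraSystem ⟨∅, {hydraH}⟩ :=
  hydraOpen_loop.cLKIDProvable (fun _ hf => hf) extends_hydraH

end HydraLoop

end HydraID

/-- The 2-Hydra statement is provable in `CLKID^ω(Σ_N, Φ_N)` but not in `LKID(Σ_N, Φ_N)` with the
`(0,s)`-axioms; the structure on `ℕ + ℤ`, with its definable sets, is a Henkin model of the
`(0,s)`-axioms in which the 2-Hydra statement is false. -/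
theorem theorem7p3 :
    HydraID.CLKIDProvable HydraID.hydraSystem ⟨∅, {HydraID.hydraH}⟩ ∧
    ¬ HydraID.LKIDProvable HydraID.hydraSystem HydraID.zeroSuccAxioms ⟨∅, {HydraID.hydraH}⟩ ∧
    HydraID.IsHenkinModel HydraID.hydraSystem HydraID.HydraUniverse
      (HydraID.definableFamily HydraID.hydraLang HydraID.HydraUniverse) ∧
    (∀ A ∈ HydraID.zeroSuccAxioms, HydraID.Models HydraID.HydraUniverse A) ∧
    ¬ HydraID.Models HydraID.HydraUniverse HydraID.hydraH := by
  exact ⟨HydraID.cLKIDProvable_hydraH, HydraID.not_LKIDProvable_hydraH,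
    HydraID.isHenkinModel_hydra, HydraID.models_zeroSuccAxioms, HydraID.not_models_hydraH⟩
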